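/- Let $\mathcal X$ be a measurable space, $n\ge 2$, and let $f:\mathcal X^n\to\mathbb R$ be bounded and measurable. For $1\le k\le n$, $y,y'\in\mathcal X$ and $\mathbf x\in\mathcal X^n$ let $$D^k_{y,y'}f(\mathbf x)=f(x_1,\dots,x_{k-1},y,x_{k+1},\dots,x_n)-f(x_1,\dots,x_{k-1},y',x_{k+1},\dots,x_n),$$ and put $$M(f)=\max_{k}\ \sup_{\mathbf x,y,y'}D^k_{y,y'}f(\mathbf x),\qquad J(f)=n\,\max_{k\ne l}\ \sup_{\mathbf x,y,y',z,z'}D^l_{z,z'}D^k_{y,y'}f(\mathbf x).$$ Let $\mathbf X=(X_1,\dots,X_{n+1})$ be i.i.d. random variables with values in $\mathcal X$ and law $\mu$. Let $$\Sigma^2(f)(\mathbf x)=\sum_{k=1}^n\tfrac12\,E_{(Y,Y')\sim\mu\times\mu}\big[(D^k_{Y,Y'}f(\mathbf x))^2\big]$$ be the sum of conditional variances, and write $E[\Sigma^2(f)]=E[\Sigma^2(f)(X_1,\dots,X_n)]$. For $\mathbf x\in\mathcal X^{n+1}$ let $$v_f(\mathbf x)=\frac1{2(n+1)}\sum_{j=1}^{n+1}\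 \sum_{i:\,i\ne j}\big(f(S^j_-\mathbf x)-f(S^j_-S^i_{x_j}\mathbf x)\big)^2,$$ where $S^i_y$ replaces the $i$-th component of a vector by $y$ and $S^j_-$ deletes the $j$-th component. Then for every $\delta\in(0,1)$, with probability at least $1-\delta$, $$\Big|\sqrt{E[\Sigma^2(f)]}-\sqrt{v_f(\mathbf X)}\Big|\le\sqrt{\big(2M(f)^2+8J(f)^2\big)\ln(2/\delta)}.$$ For each of the two one-sided bounds, $2/\delta$ can be replaced by $1/\delta$: with probability at least $1-\delta$, $$\sqrt{E[\Sigma^2(f)]}-\sqrt{v_f(\mathbf X)}\le\sqrt{\big(2M(f)^2+8J(f)^2\big)\ln(1/\delta)},$$ and with probability at least $1-\delta$, $$\sqrt{v_f(\mathbf X)}-\sqrt{E[\Sigma^2(f)]}\le\sqrt{\big(2M(f)^2+8J(f)^2\big)\ln(1/\delta)}.$$ -/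

import Mathlib

open MeasureTheory ProbabilityTheory

noncomputable section

namespace WeakInteraction

variable {𝒳 : Type*} {n : ℕ}

/-- The replacement operator `S_y^k`: replace the `k`-th component of `x` by `y`. -/
def replace (k : Fin n) (y : 𝒳) (x : Fin n → 𝒳) : Fin n → 𝒳 :=
  Function.update x k y

/-- The deletion operator `S_-^j`: delete the `j`-th component of `x`, keeping the order of
the remaining ones. -/
def delete (j : Fin (n + 1)) (x : Fin (n + 1) → 𝒳) : Fin n → 𝒳 :=
  fun i => x (j.succAbove i)

/-- The partial difference operator `D^k_{y,y'}`. -/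
def partialDiff (k : Fin n) (y y' : 𝒳) (f : (Fin n → 𝒳) → ℝ) : (Fin n → 𝒳) → ℝ :=
  fun x => f (replace k y x) - f (replace k y' x)

/-- The seminorm `M(f)`: the supremum of `D^k_{y,y'} f (x)` over all `k`, `x`, `y`, `y'`. -/
def seminormM (f : (Fin n → 𝒳) → ℝ) : ℝ :=
  ⨆ p : Fin n × (Fin n → 𝒳) × 𝒳 × 𝒳, partialDiff p.1 p.2.2.1 p.2.2.2 f p.2.1

/-- The seminorm `J(f)`: `n` times the supremum of `D^l_{z,z'} D^k_{y,y'} f (x)` over all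
pairs `l ≠ k` and all `x`, `z`, `z'`, `y`, `y'`. -/
def seminormJ (f : (Fin n → 𝒳) → ℝ) : ℝ :=
  n * ⨆ p : {q : Fin n × Fin n // q.1 ≠ q.2} × (Fin n → 𝒳) × (𝒳 × 𝒳) × (𝒳 × 𝒳),
    partialDiff p.1.1.1 p.2.2.1.1 p.2.2.1.2
      (partialDiff p.1.1.2 p.2.2.2.1 p.2.2.2.2 f) p.2.1

/-- The `k`-th conditional variance `σ_k²(f)`, for independent components with laws `μ k`. -/
def condVar [MeasurableSpace 𝒳] (μ : Fin n → Measure 𝒳) (k : Fin n)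
    (f : (Fin n → 𝒳) → ℝ) : (Fin n → 𝒳) → ℝ :=
  fun x => (1 / 2) * ∫ p : 𝒳 × 𝒳, (partialDiff k p.1 p.2 f x) ^ 2 ∂((μ k).prod (μ k))

/-- The sum of conditional variances `Σ²(f)`. -/
def sumCondVar [MeasurableSpace 𝒳] (μ : Fin n → Measure 𝒳)
    (f : (Fin n → 𝒳) → ℝ) : (Fin n → 𝒳) → ℝ :=
  fun x => ∑ k, condVar μ k f x

/-- The variance estimator `v_f`, a function of `n + 1` observations. -/
def varEstimator (f : (Fin n → 𝒳) → ℝ) : (Fin (n + 1) → 𝒳) → ℝ :=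
  fun x => 1 / (2 * ((n : ℝ) + 1)) *
    ∑ j : Fin (n + 1), ∑ i ∈ Finset.univ.erase j,
      (f (delete j x) - f (delete j (replace i (x j) x))) ^ 2

end WeakInteraction

end

set_option linter.unusedSectionVars false

/-! Identify the `n + 1` indices with the integers mod `n + 1`. Every ordered pair `(i, j)` with `i
≠ j` has exactly one sum `c = i + j`, so `v_f` is the average over `c` of statistics built from the
matching `i ↦ c - i` (`varEstimator_eq_average`). Write `W` for one of these: half the sum of
squares `G i ^ 2`, where `G i` is the absolute difference attached to `i` and its partner, and put
`a = 2M² + 8J²`.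

The gain of a matching is that its pairs are disjoint blocks of coordinates. Resampling one block
can destroy that block's own squares, and it moves every other `G i` by at most `2J/n`, since the
change is a sum of two mixed second differences. The decrease of `W` is therefore at most an
oscillation `U k ≤ a`, and Cauchy–Schwarz gives `∑ U k ^ 2 ≤ a * W` (`sum_sq_osc_le`): `W` is
self-bounding with respect to blocks.

Subadditivity of entropy over blocks (`entropy_le_sum_of_cover`), applied to `exp (t * W)`, bounds
its entropy by a multiple of `E[W * exp (t * W)]`. Herbst's argument integrates this to bounds on
the cumulant generating function of the form `r(t) * E[W]`. Convexity of `exp` carries them to the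
average over `c`, whatever the dependence between the matchings (`mgf_average_le`).

As `v_f` is unbiased for `E[Σ²(f)]` (`integral_varEstimator`), Chernoff's method gives both tails
`exp (-t² / a)` on the square-root scale. The two-sided bound is a union bound at level `δ / 2`. -/

namespace WeakInteraction

/-! ### Partial averages over blocks of coordinates -/

section Resampling

variable {ι 𝒳 : Type*} [Fintype ι] [DecidableEq ι] [MeasurableSpace 𝒳]

theorem measurable_piecewise_pair (s : Finset ι) :
    Measurable fun p : (ι → 𝒳) × (ι → 𝒳) => s.piecewise p.1 p.2 := by
  refine measurable_pi_lambda _ fun i => ?_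
  by_cases hi : i ∈ s
  · simpa [hi, Function.comp_def] using (measurable_pi_apply i).comp measurable_fst
  · simpa [hi, Function.comp_def] using (measurable_pi_apply i).comp measurable_snd

theorem measurable_piecewise_left (s : Finset ι) (x : ι → 𝒳) :
    Measurable fun z : ι → 𝒳 => s.piecewise z x :=
  (measurable_piecewise_pair s).comp (measurable_id.prodMk measurable_const)

variable (μ : ι → Measure 𝒳) [∀ i, IsProbabilityMeasure (μ i)]

/-- Lets a block average be an integral against a full independent copy of the sample, so that the
product space never has to be split into factors. -/
theorem measurePreserving_piecewise (s : Finset ι) :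
    MeasurePreserving (fun p : (ι → 𝒳) × (ι → 𝒳) => s.piecewise p.1 p.2)
      ((Measure.pi μ).prod (Measure.pi μ)) (Measure.pi μ) := by
  refine ⟨measurable_piecewise_pair s, (Measure.pi_eq fun t ht => ?_).symm⟩
  rw [Measure.map_apply (measurable_piecewise_pair s) (MeasurableSet.univ_pi ht)]
  have hpre : (fun p : (ι → 𝒳) × (ι → 𝒳) => s.piecewise p.1 p.2) ⁻¹' Set.univ.pi t
      = (Set.univ.pi fun i => if i ∈ s then t i else Set.univ) ×ˢ
        (Set.univ.pi fun i => if i ∈ s then Set.univ else t i) := by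
    ext p
    simp only [Set.mem_preimage, Set.mem_pi, Set.mem_univ, true_imp_iff, Set.mem_prod]
    rw [← forall_and]
    refine forall_congr' fun i => ?_
    by_cases hi : i ∈ s <;> simp [hi]
  rw [hpre, Measure.prod_prod, Measure.pi_pi, Measure.pi_pi, ← Finset.prod_mul_distrib]
  refine Finset.prod_congr rfl fun i _ => ?_
  by_cases hi : i ∈ s <;> simp [hi]

/-- Bounded measurable real functions. -/
def BoundedMeasurable {α : Type*} [MeasurableSpace α] (F : α → ℝ) : Prop :=
  Measurable F ∧ ∃ C, ∀ x, |F x| ≤ C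

namespace BoundedMeasurable

variable {α β : Type*} [MeasurableSpace α] [MeasurableSpace β] {F G : α → ℝ}

theorem integrable (hF : BoundedMeasurable F) (ν : Measure α) [IsFiniteMeasure ν] :
    Integrable F ν := by
  obtain ⟨hm, C, hC⟩ := hF
  exact Integrable.of_bound hm.aestronglyMeasurable C (.of_forall fun x => by simpa using hC x)

theorem comp (hF : BoundedMeasurable F) {g : β → α} (hg : Measurable g) :
    BoundedMeasurable fun x => F (g x) :=
  ⟨hF.1.comp hg, hF.2.imp fun _ hC x => hC (g x)⟩

theorem const (c : ℝ) : BoundedMeasurable fun _ : α => c :=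
  ⟨measurable_const, |c|, fun _ => le_rfl⟩

theorem add (hF : BoundedMeasurable F) (hG : BoundedMeasurable G) :
    BoundedMeasurable fun x => F x + G x := by
  obtain ⟨hF, C, hC⟩ := hF
  obtain ⟨hG, D, hD⟩ := hG
  exact ⟨hF.add hG, C + D, fun x => (abs_add_le _ _).trans (add_le_add (hC x) (hD x))⟩

theorem mul (hF : BoundedMeasurable F) (hG : BoundedMeasurable G) :
    BoundedMeasurable fun x => F x * G x := by
  obtain ⟨hF, C, hC⟩ := hF
  obtain ⟨hG, D, hD⟩ := hG
  refine ⟨hF.mul hG, C * D, fun x => ?_⟩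
  rw [abs_mul]
  exact mul_le_mul (hC x) (hD x) (abs_nonneg _) ((abs_nonneg _).trans (hC x))

theorem const_mul (c : ℝ) (hF : BoundedMeasurable F) : BoundedMeasurable fun x => c * F x :=
  (const c).mul hF

theorem sub (hF : BoundedMeasurable F) (hG : BoundedMeasurable G) :
    BoundedMeasurable fun x => F x - G x := by
  simpa [sub_eq_add_neg] using hF.add (hG.const_mul (-1))

theorem pow (hF : BoundedMeasurable F) (k : ℕ) : BoundedMeasurable fun x => F x ^ k := by
  obtain ⟨hF, C, hC⟩ := hF
  refine ⟨hF.pow_const k, C ^ k, fun x => ?_⟩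
  rw [abs_pow]
  exact pow_le_pow_left₀ (abs_nonneg _) (hC x) k

theorem abs (hF : BoundedMeasurable F) : BoundedMeasurable fun x => |F x| :=
  ⟨by simpa using hF.1.norm, hF.2.imp fun _ hC x => by simpa using hC x⟩

theorem sum {κ : Type*} (K : Finset κ) {F : κ → α → ℝ}
    (hF : ∀ k ∈ K, BoundedMeasurable (F k)) : BoundedMeasurable fun x => ∑ k ∈ K, F k x := by
  classical
  induction K using Finset.induction_on with
  | empty => simpa using const 0
  | insert k K hk ih =>
    simp only [Finset.sum_insert hk]
    exact (hF k (Finset.mem_insert_self _ _)).add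
      (ih fun j hj => hF j (Finset.mem_insert_of_mem hj))

theorem exp (hF : BoundedMeasurable F) : BoundedMeasurable fun x => Real.exp (F x) := by
  obtain ⟨hF, C, hC⟩ := hF
  refine ⟨hF.exp, Real.exp C, fun x => ?_⟩
  rw [abs_of_pos (Real.exp_pos _)]
  exact Real.exp_le_exp.2 ((le_abs_self _).trans (hC x))

theorem log (hF : BoundedMeasurable F) {c : ℝ} (hc : 0 < c) (hcF : ∀ x, c ≤ F x) :
    BoundedMeasurable fun x => Real.log (F x) := by
  obtain ⟨hF, C, hC⟩ := hF
  refine ⟨hF.log, |Real.log c| + |Real.log C|, fun x => ?_⟩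
  have h1 : Real.log c ≤ Real.log (F x) := Real.log_le_log hc (hcF x)
  have h2 : Real.log (F x) ≤ Real.log C :=
    Real.log_le_log (hc.trans_le (hcF x)) ((le_abs_self _).trans (hC x))
  rw [abs_le]
  constructor
  · linarith [neg_abs_le (Real.log c), abs_nonneg (Real.log C)]
  · linarith [le_abs_self (Real.log C), abs_nonneg (Real.log c)]

end BoundedMeasurable

/-- The expectation of `F` over the coordinates in `s`, the others being kept fixed. -/
noncomputable def blockMean (s : Finset ι) (F : (ι → 𝒳) → ℝ) (x : ι → 𝒳) : ℝ :=
  ∫ z, F (s.piecewise z x) ∂(Measure.pi μ)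

variable {μ}

theorem blockMean_congr (s : Finset ι) (F : (ι → 𝒳) → ℝ) {x y : ι → 𝒳}
    (h : ∀ i ∉ s, x i = y i) : blockMean μ s F x = blockMean μ s F y := by
  unfold blockMean
  have : ∀ z : ι → 𝒳, s.piecewise z x = s.piecewise z y := fun z => by
    ext i
    by_cases hi : i ∈ s <;> simp [hi, h]
  simp [this]

theorem integral_blockMean (s : Finset ι) {F : (ι → 𝒳) → ℝ} (hF : BoundedMeasurable F) :
    ∫ x, blockMean μ s F x ∂(Measure.pi μ) = ∫ x, F x ∂(Measure.pi μ) := by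
  have hp := measurePreserving_piecewise μ s
  unfold blockMean
  rw [← integral_prod_symm (fun p : (ι → 𝒳) × (ι → 𝒳) => F (s.piecewise p.1 p.2))
    ((hF.comp (measurable_piecewise_pair s)).integrable _)]
  conv_rhs => rw [← hp.map_eq]
  rw [integral_map hp.measurable.aemeasurable hF.1.aestronglyMeasurable]

theorem blockMean_union (s t : Finset ι) {F : (ι → 𝒳) → ℝ}
    (hF : BoundedMeasurable F) (x : ι → 𝒳) :
    blockMean μ (s ∪ t) F x = blockMean μ s (blockMean μ t F) x := by
  have key : ∀ z z' : ι → 𝒳, t.piecewise z' (s.piecewise z x)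
      = (s ∪ t).piecewise (t.piecewise z' z) x := fun z z' => by
    ext i
    by_cases ht : i ∈ t <;> by_cases hs : i ∈ s <;> simp [ht, hs]
  have := integral_blockMean (μ := μ) t (F := fun w => F ((s ∪ t).piecewise w x))
    (hF.comp (measurable_piecewise_left _ x))
  unfold blockMean at *
  simp only [key]
  exact this.symm

theorem blockMean_empty (F : (ι → 𝒳) → ℝ) (x : ι → 𝒳) : blockMean μ ∅ F x = F x := by
  have : ∀ z, F ((∅ : Finset ι).piecewise z x) = F x := fun z =>
    congrArg F (funext fun i => by simp [Finset.piecewise])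
  unfold blockMean
  rw [integral_congr_ae (.of_forall this)]
  simp

theorem blockMean_univ (F : (ι → 𝒳) → ℝ) (x : ι → 𝒳) :
    blockMean μ Finset.univ F x = ∫ z, F z ∂(Measure.pi μ) := by
  simp [blockMean]

theorem le_blockMean {s : Finset ι} {F : (ι → 𝒳) → ℝ} (hF : BoundedMeasurable F) {c : ℝ}
    (hc : ∀ x, c ≤ F x) (x : ι → 𝒳) : c ≤ blockMean μ s F x := by
  have := integral_mono (μ := Measure.pi μ) (integrable_const c)
    ((hF.comp (measurable_piecewise_left s x)).integrable _) (fun z => hc _)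
  simpa [blockMean] using this

theorem BoundedMeasurable.blockMean {s : Finset ι} {F : (ι → 𝒳) → ℝ}
    (hF : BoundedMeasurable F) : BoundedMeasurable (blockMean μ s F) := by
  refine ⟨?_, ?_⟩
  · have : StronglyMeasurable fun p : (ι → 𝒳) × (ι → 𝒳) => F (s.piecewise p.2 p.1) :=
      (hF.1.comp ((measurable_piecewise_pair s).comp measurable_swap)).stronglyMeasurable
    exact (this.integral_prod_right (ν := Measure.pi μ)).measurable
  · obtain ⟨hm, C, hC⟩ := hF
    refine ⟨C, fun x => ?_⟩
    have := norm_integral_le_of_norm_le_const (μ := Measure.pi μ)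
      (f := fun z => F (s.piecewise z x)) (C := C) (.of_forall fun z => by simpa using hC _)
    simpa [WeakInteraction.blockMean] using this

end Resampling

/-! ### Subadditivity of entropy over blocks -/

section Entropy

variable {ι 𝒳 : Type*} [Fintype ι] [DecidableEq ι] [MeasurableSpace 𝒳]
  {μ : ι → Measure 𝒳} [∀ i, IsProbabilityMeasure (μ i)]

/-- This joins two variational formulas for the entropy conditional on the coordinates outside `s`:
it is the supremum of `E[F (log H - log E H)]` over `H`, and the infimum of `E[F log (F / u) - F +
u]` over `u`. With `h` the block mean of `H`, the pointwise gap between the two integrands is at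
most `u / h * H - u`, whose block mean is zero. -/
theorem integral_mul_log_sub_log_blockMean_le {s : Finset ι} {F H R : (ι → 𝒳) → ℝ}
    (hF : BoundedMeasurable F) (hH : BoundedMeasurable H) (hR : BoundedMeasurable R)
    {c : ℝ} (hc : 0 < c) (hcF : ∀ x, c ≤ F x) (hcH : ∀ x, c ≤ H x)
    (hFR : ∀ x : ι → 𝒳, ∃ u > 0, ∀ z : ι → 𝒳, (∀ i ∉ s, z i = x i) →
      F z * Real.log (F z / u) - F z + u ≤ R z) :
    ∫ x, F x * (Real.log (H x) - Real.log (blockMean μ s H x)) ∂(Measure.pi μ)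
      ≤ ∫ x, R x ∂(Measure.pi μ) := by
  have hQ : BoundedMeasurable fun x => F x * (Real.log (H x) - Real.log (blockMean μ s H x)) :=
    hF.mul ((hH.log hc hcH).sub (hH.blockMean.log hc (le_blockMean hH hcH)))
  rw [← integral_blockMean s hQ, ← integral_blockMean s hR]
  refine integral_mono (hQ.blockMean.integrable _) (hR.blockMean.integrable _) fun x => ?_
  obtain ⟨u, hu, hux⟩ := hFR x
  set h := blockMean μ s H x with hh
  have hh0 : 0 < h := hc.trans_le (le_blockMean hH hcH x)
  have hpw := measurable_piecewise_left (𝒳 := 𝒳) s x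
  have hHx := hH.comp hpw
  have hRx := hR.comp hpw
  have hbd : BoundedMeasurable fun z => u / h * H (s.piecewise z x) + (-u) :=
    (hHx.const_mul _).add (BoundedMeasurable.const _)
  have hlast : ∫ z, (u / h * H (s.piecewise z x) + (-u)) ∂(Measure.pi μ) = 0 := by
    rw [integral_add ((hHx.const_mul _).integrable _) (integrable_const _), integral_const_mul]
    have : ∫ z, H (s.piecewise z x) ∂(Measure.pi μ) = h := rfl
    rw [this]
    simp only [integral_const, probReal_univ, smul_eq_mul]
    field_simp
    ring
  calc blockMean μ s (fun x => F x * (Real.log (H x) - Real.log (blockMean μ s H x))) x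
      ≤ ∫ z, (R (s.piecewise z x) + (u / h * H (s.piecewise z x) + (-u))) ∂(Measure.pi μ) := by
        refine integral_mono ((hQ.comp hpw).integrable _) ((hRx.add hbd).integrable _)
          fun z => ?_
        have hz : ∀ i ∉ s, s.piecewise z x i = x i := fun i hi => by simp [hi]
        have h1 := hux _ hz
        have h2 : blockMean μ s H (s.piecewise z x) = h := blockMean_congr s H hz
        simp only [h2]
        set w := s.piecewise z x
        have hFw : 0 < F w := hc.trans_le (hcF w)
        have hHw : 0 < H w := hc.trans_le (hcH w)
        -- Multiplied by `F w`, this is the only inequality used; `u` and `h` are constant on the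
        -- block.
        have h3 := Real.log_le_sub_one_of_pos (x := u * H w / (h * F w)) (by positivity)
        rw [Real.log_div (by positivity) (by positivity), Real.log_mul hu.ne' hHw.ne',
          Real.log_mul hh0.ne' hFw.ne'] at h3
        rw [Real.log_div hFw.ne' hu.ne'] at h1
        have h4 := mul_le_mul_of_nonneg_left h3 hFw.le
        have h5 : F w * (u * H w / (h * F w) - 1) = u / h * H w - F w := by field_simp
        rw [h5] at h4
        linarith
    _ = blockMean μ s R x := by
        rw [integral_add (hRx.integrable _) (hbd.integrable _), hlast, add_zero]
        rfl

/-- Subadditivity of entropy over a cover of the coordinates into blocks. -/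
theorem entropy_le_sum_of_cover {κ : Type*} (K : Finset κ) (s : κ → Finset ι)
    (hcover : K.biUnion s = Finset.univ)
    {F : (ι → 𝒳) → ℝ} {R : κ → (ι → 𝒳) → ℝ} (hF : BoundedMeasurable F)
    (hR : ∀ k ∈ K, BoundedMeasurable (R k)) {c : ℝ} (hc : 0 < c) (hcF : ∀ x, c ≤ F x)
    (hFR : ∀ k ∈ K, ∀ x : ι → 𝒳, ∃ u > 0, ∀ z : ι → 𝒳, (∀ i ∉ s k, z i = x i) →
      F z * Real.log (F z / u) - F z + u ≤ R k z) :
    ∫ x, F x * Real.log (F x) ∂(Measure.pi μ)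
        - (∫ x, F x ∂(Measure.pi μ)) * Real.log (∫ x, F x ∂(Measure.pi μ))
      ≤ ∑ k ∈ K, ∫ x, R k x ∂(Measure.pi μ) := by
  classical
  have hlog : BoundedMeasurable fun x => F x * Real.log (F x) := hF.mul (hF.log hc hcF)
  have hlogm : ∀ t : Finset ι, BoundedMeasurable fun x => F x * Real.log (blockMean μ t F x) :=
    fun t => hF.mul (hF.blockMean.log hc (le_blockMean hF hcF))
  -- The entropy telescopes as blocks are averaged out one at a time, from `F` itself to its mean.
  -- Averaging over a union is iterated averaging, so the blocks may overlap.
  have main : ∀ K' ⊆ K, ∫ x, F x * Real.log (F x) ∂(Measure.pi μ)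
      - ∫ x, F x * Real.log (blockMean μ (K'.biUnion s) F x) ∂(Measure.pi μ)
      ≤ ∑ k ∈ K', ∫ x, R k x ∂(Measure.pi μ) := by
    intro K'
    induction K' using Finset.induction_on with
    | empty =>
      intro _
      simp [blockMean_empty]
    | insert k K' hk ih =>
      intro hK
      have hkK : k ∈ K := hK (Finset.mem_insert_self _ _)
      have hK' : K' ⊆ K := (Finset.subset_insert _ _).trans hK
      have h1 := integral_mul_log_sub_log_blockMean_le (μ := μ) (s := s k) hF
        (hF.blockMean (μ := μ) (s := K'.biUnion s)) (hR k hkK) hc hcF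
        (le_blockMean hF hcF) (hFR k hkK)
      have h2 : ∀ x, blockMean μ (s k) (blockMean μ (K'.biUnion s) F) x
          = blockMean μ ((insert k K').biUnion s) F x := fun x => by
        rw [Finset.biUnion_insert, blockMean_union _ _ hF]
      simp only [h2, mul_sub] at h1
      rw [integral_sub ((hlogm _).integrable _) ((hlogm _).integrable _)] at h1
      rw [Finset.sum_insert hk]
      linarith [ih hK']
  have := main K subset_rfl
  simpa [hcover, blockMean_univ, integral_mul_const] using this

end Entropy

/-! ### Herbst's argument: from entropy bounds to cumulant bounds -/

section Herbst

open Filter Topology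

variable {Ω : Type*} [MeasurableSpace Ω] {P : Measure Ω} [IsProbabilityMeasure P] {W : Ω → ℝ}

theorem BoundedMeasurable.exp_mul (hW : BoundedMeasurable W) (t : ℝ) :
    BoundedMeasurable fun ω => Real.exp (t * W ω) :=
  (hW.const_mul t).exp

theorem BoundedMeasurable.hasDerivAt_cgf (hW : BoundedMeasurable W) (t : ℝ) :
    HasDerivAt (cgf W P) ((∫ ω, W ω * Real.exp (t * W ω) ∂P) / mgf W P t) t := by
  have huniv : integrableExpSet W P = Set.univ := by
    ext t
    simpa [integrableExpSet] using (hW.exp_mul t).integrable P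
  exact (hasDerivAt_mgf (by simp [huniv])).log (mgf_pos ((hW.exp_mul t).integrable P)).ne'

theorem BoundedMeasurable.hasDerivAt_cgf_zero (hW : BoundedMeasurable W) :
    HasDerivAt (cgf W P) (∫ ω, W ω ∂P) 0 := by
  simpa using hW.hasDerivAt_cgf (P := P) 0

theorem le_of_antitoneOn_of_tendsto {K : ℝ → ℝ} {l : ℝ} (hK : AntitoneOn K (Set.Ioi 0))
    (hl : Tendsto K (𝓝[>] 0) (𝓝 l)) {θ : ℝ} (hθ : 0 < θ) : K θ ≤ l := by
  refine ge_of_tendsto hl ?_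
  filter_upwards [Ioo_mem_nhdsGT hθ] with ε hε
  exact hK hε.1 hθ hε.2.le

theorem tendsto_div_of_hasDerivAt_zero {G : ℝ → ℝ} {g : ℝ} (hG : HasDerivAt G g 0)
    (h0 : G 0 = 0) : Tendsto (fun t => G t / t) (𝓝[>] 0) (𝓝 g) := by
  have := hG.tendsto_slope_zero_right
  simpa [h0, div_eq_inv_mul] using this

/-- The entropy inequality says exactly that `cgf(-s) / (1 - exp (-s * a))` has nonpositive
derivative for `s > 0`. Its limit at `0` is `-E[W] / a`, which therefore bounds it. -/
theorem cgf_neg_le_of_entropy_le (hW : BoundedMeasurable W) {a : ℝ} (ha : 0 < a)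
    (hent : ∀ θ > 0, -θ * (∫ ω, W ω * Real.exp (-θ * W ω) ∂P)
        - mgf W P (-θ) * cgf W P (-θ)
      ≤ (Real.exp (θ * a) - θ * a - 1) / a * ∫ ω, W ω * Real.exp (-θ * W ω) ∂P)
    {θ : ℝ} (hθ : 0 < θ) :
    cgf W P (-θ) ≤ -((1 - Real.exp (-(θ * a))) / a * ∫ ω, W ω ∂P) := by
  set q : ℝ → ℝ := fun t => (∫ ω, W ω * Real.exp (t * W ω) ∂P) / mgf W P t with hq
  have hG : ∀ t, HasDerivAt (fun s => cgf W P (-s)) (-q (-t)) t := fun t => by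
    have := (hW.hasDerivAt_cgf (P := P) (-t)).scomp t (hasDerivAt_neg t)
    simpa [Function.comp_def, hq] using this
  have hE : ∀ t, HasDerivAt (fun s => 1 - Real.exp (-(s * a))) (a * Real.exp (-(t * a))) t :=
    fun t => by
      have := (((hasDerivAt_id t).mul_const a).neg.exp).const_sub 1
      refine this.congr_deriv ?_
      simp only [id, Pi.neg_apply]
      ring
  have hEpos : ∀ t > 0, 0 < 1 - Real.exp (-(t * a)) := fun t ht => by
    have : Real.exp (-(t * a)) < 1 := by
      have := mul_pos ht ha
      simpa using this
    linarith
  have hineq : ∀ t > 0, -cgf W P (-t) ≤ (Real.exp (t * a) - 1) / a * q (-t) := fun t ht => by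
    have hm : 0 < mgf W P (-t) := mgf_pos ((hW.exp_mul (-t)).integrable P)
    have h := hent t ht
    have hd : ∫ ω, W ω * Real.exp (-t * W ω) ∂P = mgf W P (-t) * q (-t) := by
      simp only [hq]
      exact (mul_div_cancel₀ _ hm.ne').symm
    rw [hd] at h
    refine le_of_mul_le_mul_left ?_ hm
    have e : (Real.exp (t * a) - t * a - 1) / a = (Real.exp (t * a) - 1) / a - t := by
      field_simp; ring
    rw [e] at h
    nlinarith [h]
  have hK : ∀ t > 0, HasDerivAt (fun s => cgf W P (-s) / (1 - Real.exp (-(s * a))))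
      ((-q (-t) * (1 - Real.exp (-(t * a))) - cgf W P (-t) * (a * Real.exp (-(t * a))))
        / (1 - Real.exp (-(t * a))) ^ 2) t :=
    fun t ht => (hG t).div (hE t) (hEpos t ht).ne'
  have hanti : AntitoneOn (fun s => cgf W P (-s) / (1 - Real.exp (-(s * a)))) (Set.Ioi 0) := by
    refine antitoneOn_of_deriv_nonpos (convex_Ioi 0)
      (fun t ht => (hK t ht).continuousAt.continuousWithinAt)
      (fun t ht => (hK t (by simpa using ht)).differentiableAt.differentiableWithinAt)
      fun t ht => ?_
    rw [interior_Ioi] at ht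
    rw [(hK t ht).deriv]
    refine div_nonpos_of_nonpos_of_nonneg ?_ (sq_nonneg _)
    have h1 := mul_le_mul_of_nonneg_right (hineq t ht)
      (by positivity : 0 ≤ a * Real.exp (-(t * a)))
    have h2 : (Real.exp (t * a) - 1) / a * q (-t) * (a * Real.exp (-(t * a)))
        = q (-t) * (1 - Real.exp (-(t * a))) := by
      have h3 : Real.exp (t * a) * Real.exp (-(t * a)) = 1 := by
        rw [← Real.exp_add]; simp
      field_simp
      linear_combination q (-t) * h3
    rw [h2] at h1
    linarith
  have hlim : Tendsto (fun s => cgf W P (-s) / (1 - Real.exp (-(s * a)))) (𝓝[>] 0)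
      (𝓝 (-(∫ ω, W ω ∂P) / a)) := by
    have h1 := tendsto_div_of_hasDerivAt_zero (hG 0) (by simp)
    have h2 := tendsto_div_of_hasDerivAt_zero (hE 0) (by simp)
    have h3 := h1.div h2 (by simpa using ha.ne')
    have e : -q (-0) / (a * Real.exp (-(0 * a))) = -(∫ ω, W ω ∂P) / a := by simp [hq]
    rw [e] at h3
    refine h3.congr' ?_
    filter_upwards [self_mem_nhdsWithin] with s hs
    exact div_div_div_cancel_right₀ (ne_of_gt hs) _ _
  have := le_of_antitoneOn_of_tendsto hanti hlim hθ
  rw [div_le_iff₀ (hEpos θ hθ)] at this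
  refine this.trans_eq ?_
  ring

/-- Here the nonincreasing function is `cgf(s) / s - c * cgf(s)`, with limit `E[W]` at `0`; solving
for `cgf` needs `c * θ < 1`. -/
theorem cgf_le_of_entropy_le (hW : BoundedMeasurable W) {c : ℝ}
    (hent : ∀ θ > 0, θ * (∫ ω, W ω * Real.exp (θ * W ω) ∂P) - mgf W P θ * cgf W P θ
      ≤ c * θ ^ 2 * ∫ ω, W ω * Real.exp (θ * W ω) ∂P)
    {θ : ℝ} (hθ : 0 < θ) (hcθ : c * θ < 1) :
    cgf W P θ ≤ θ / (1 - c * θ) * ∫ ω, W ω ∂P := by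
  set q : ℝ → ℝ := fun t => (∫ ω, W ω * Real.exp (t * W ω) ∂P) / mgf W P t with hq
  have hG : ∀ t, HasDerivAt (cgf W P) (q t) t := fun t => hW.hasDerivAt_cgf t
  have hineq : ∀ t > 0, t * q t - cgf W P t ≤ c * t ^ 2 * q t := fun t ht => by
    have hm : 0 < mgf W P t := mgf_pos ((hW.exp_mul t).integrable P)
    have h := hent t ht
    have hd : ∫ ω, W ω * Real.exp (t * W ω) ∂P = mgf W P t * q t := by
      simp only [hq]
      exact (mul_div_cancel₀ _ hm.ne').symm
    rw [hd] at h
    refine le_of_mul_le_mul_left ?_ hm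
    linarith [h]
  have hK : ∀ t > 0, HasDerivAt (fun s => cgf W P s / s - c * cgf W P s)
      ((q t * t - cgf W P t * 1) / t ^ 2 - c * q t) t :=
    fun t ht => ((hG t).div (hasDerivAt_id t) (ne_of_gt ht)).sub ((hG t).const_mul c)
  have hanti : AntitoneOn (fun s => cgf W P s / s - c * cgf W P s) (Set.Ioi 0) := by
    refine antitoneOn_of_deriv_nonpos (convex_Ioi 0)
      (fun t ht => (hK t ht).continuousAt.continuousWithinAt)
      (fun t ht => (hK t (by simpa using ht)).differentiableAt.differentiableWithinAt)
      fun t ht => ?_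
    rw [interior_Ioi] at ht
    have ht' : 0 < t := ht
    rw [(hK t ht).deriv, sub_nonpos, div_le_iff₀ (by positivity)]
    linarith [hineq t ht]
  have hlim : Tendsto (fun s => cgf W P s / s - c * cgf W P s) (𝓝[>] 0)
      (𝓝 (∫ ω, W ω ∂P)) := by
    have h1 := tendsto_div_of_hasDerivAt_zero (hW.hasDerivAt_cgf_zero (P := P)) (by simp)
    have h2 : Tendsto (fun s => c * cgf W P s) (𝓝[>] 0) (𝓝 (c * cgf W P 0)) :=
      ((hG 0).continuousAt.tendsto.const_mul c).mono_left nhdsWithin_le_nhds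
    simpa using h1.sub h2
  have := le_of_antitoneOn_of_tendsto hanti hlim hθ
  have hpos : 0 < 1 - c * θ := by linarith
  rw [div_mul_eq_mul_div, le_div_iff₀ hpos]
  have h2 := mul_le_mul_of_nonneg_left this hθ.le
  have h3 : θ * (cgf W P θ / θ - c * cgf W P θ) = cgf W P θ * (1 - c * θ) := by
    field_simp
  simp only [h3] at h2
  exact h2

end Herbst

/-! ### Exponential moments of block self-bounding functions -/

section SelfBounding

theorem exp_neg_add_sub_one_le {x : ℝ} (hx : 0 ≤ x) : Real.exp (-x) + x - 1 ≤ x ^ 2 / 2 := by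
  have h1 := Real.quadratic_le_exp_of_nonneg hx
  have h2 : Real.exp (-x) = 1 / Real.exp x := by rw [Real.exp_neg, one_div]
  have hp : 0 < 1 + x + x ^ 2 / 2 := by positivity
  have h3 : Real.exp (-x) ≤ 1 / (1 + x + x ^ 2 / 2) := by
    rw [h2]; exact one_div_le_one_div_of_le hp h1
  have h4 : 1 / (1 + x + x ^ 2 / 2) ≤ 1 - x + x ^ 2 / 2 := by
    rw [div_le_iff₀ hp]
    -- The product `(1 + x + x²/2) (1 - x + x²/2)` equals `1 + x⁴/4`.
    nlinarith [sq_nonneg (x ^ 2)]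
  linarith

/-- This is the monotonicity of `(exp y - y - 1) / y²`, obtained by fixing the ratio `r = y / b` and
differentiating in `b`; the derivative is nonnegative by convexity of `exp` between `0` and `t`. -/
theorem exp_sub_le_sq_div {y b : ℝ} (hy : 0 ≤ y) (hyb : y ≤ b) (hb : 0 < b) :
    Real.exp y - y - 1 ≤ (Real.exp b - b - 1) * (y / b) ^ 2 := by
  set r := y / b with hr
  have hr0 : 0 ≤ r := by positivity
  have hr1 : r ≤ 1 := (div_le_one hb).2 hyb
  have hy' : y = r * b := by rw [hr]; field_simp
  have hd : ∀ t, HasDerivAt (fun t => (Real.exp t - t - 1) * r ^ 2 - (Real.exp (r * t) - r * t - 1))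
      ((Real.exp t - 1) * r ^ 2 - (Real.exp (r * t) * r - r)) t := fun t => by
    have h1 := (((Real.hasDerivAt_exp t).sub (hasDerivAt_id t)).sub_const 1).mul_const (r ^ 2)
    have h0 : HasDerivAt (fun t => r * t) r t := by
      simpa using (hasDerivAt_id t).const_mul r
    exact h1.sub ((h0.exp.sub h0).sub_const 1)
  have hmono : MonotoneOn
      (fun t => (Real.exp t - t - 1) * r ^ 2 - (Real.exp (r * t) - r * t - 1)) (Set.Ici 0) := by
    refine monotoneOn_of_deriv_nonneg (convex_Ici 0)
      (fun t _ => (hd t).continuousAt.continuousWithinAt)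
      (fun t _ => (hd t).differentiableAt.differentiableWithinAt) fun t _ => ?_
    rw [(hd t).deriv]
    have hconv := convexOn_exp.2 (Set.mem_univ 0) (Set.mem_univ t) (sub_nonneg.2 hr1) hr0
      (by ring)
    simp only [smul_eq_mul, mul_zero, zero_add, Real.exp_zero, mul_one] at hconv
    nlinarith [mul_le_mul_of_nonneg_left hconv hr0]
  have := hmono (Set.self_mem_Ici) (Set.mem_Ici.2 hb.le) hb.le
  simp only [mul_zero, Real.exp_zero, sub_self, zero_mul, sub_zero] at this
  rw [hy']
  linarith

variable {ι 𝒳 κ : Type*} [DecidableEq ι] [MeasurableSpace 𝒳]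

/-- `W` decreases by at most `U k` when the coordinates in the block `s k` are changed, and the
squares of these oscillations are controlled by `W` itself. -/
structure IsBlockSelfBounding (K : Finset κ) (s : κ → Finset ι) (a : ℝ) (W : (ι → 𝒳) → ℝ)
    (U : κ → (ι → 𝒳) → ℝ) : Prop where
  boundedMeasurable : BoundedMeasurable W
  boundedMeasurable_osc : ∀ k ∈ K, BoundedMeasurable (U k)
  nonneg : ∀ x, 0 ≤ W x
  osc_le : ∀ k ∈ K, ∀ x, U k x ≤ a
  sub_le : ∀ k ∈ K, ∀ x y, (∀ i ∉ s k, y i = x i) → W x - W y ≤ U k x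
  sum_sq_le : ∀ x, ∑ k ∈ K, U k x ^ 2 ≤ a * W x

variable [Fintype ι] {μ : ι → Measure 𝒳} [∀ i, IsProbabilityMeasure (μ i)]
  {K : Finset κ} {s : κ → Finset ι} {a : ℝ} {W : (ι → 𝒳) → ℝ} {U : κ → (ι → 𝒳) → ℝ}

namespace IsBlockSelfBounding

/-- With `d` the drop from `W` to its infimum over a block, the block's entropy integrand is `exp (t
* W) * (t * d - 1 + exp (-(t * d)))`. The quadratic bound `htb` and `∑ U k ^ 2 ≤ a * W` bring back
`W` itself. It is used for both signs of `t`. -/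
theorem entropy_exp_le (h : IsBlockSelfBounding K s a W U) (hcover : K.biUnion s = Finset.univ)
    {t b : ℝ} (hb : 0 ≤ b)
    (htb : ∀ k ∈ K, ∀ x, ∀ d, 0 ≤ d → d ≤ U k x → t * d - 1 + Real.exp (-(t * d)) ≤ b * U k x ^ 2) :
    t * (∫ x, W x * Real.exp (t * W x) ∂(Measure.pi μ))
        - mgf W (Measure.pi μ) t * cgf W (Measure.pi μ) t
      ≤ b * a * ∫ x, W x * Real.exp (t * W x) ∂(Measure.pi μ) := by
  have hF := h.boundedMeasurable.exp_mul t
  have hR : ∀ k ∈ K, BoundedMeasurable fun x => b * (Real.exp (t * W x) * U k x ^ 2) :=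
    fun k hk => (hF.mul ((h.boundedMeasurable_osc k hk).pow 2)).const_mul b
  obtain ⟨C, hC⟩ := h.boundedMeasurable.2
  have hlow : ∀ x, Real.exp (-(|t| * C)) ≤ Real.exp (t * W x) := fun x => by
    rw [Real.exp_le_exp]
    have h1 : |t * W x| ≤ |t| * C := by
      rw [abs_mul]; exact mul_le_mul_of_nonneg_left (hC x) (abs_nonneg t)
    linarith [neg_abs_le (t * W x)]
  have hent := entropy_le_sum_of_cover (μ := μ) K s hcover hF hR (Real.exp_pos _) hlow ?_
  · have e1 : ∫ x, Real.exp (t * W x) * Real.log (Real.exp (t * W x)) ∂(Measure.pi μ)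
        = t * ∫ x, W x * Real.exp (t * W x) ∂(Measure.pi μ) := by
      rw [← integral_const_mul]
      congr 1
      ext x
      rw [Real.log_exp]
      ring
    rw [e1] at hent
    refine hent.trans ?_
    rw [← integral_finsetSum _ fun k hk => (hR k hk).integrable _, ← integral_const_mul]
    refine integral_mono ((BoundedMeasurable.sum K hR).integrable _)
      (((h.boundedMeasurable.mul hF).const_mul _).integrable _) fun x => ?_
    have := mul_le_mul_of_nonneg_left (h.sum_sq_le x)
      (mul_nonneg hb (Real.exp_pos (t * W x)).le)
    simp only [← Finset.mul_sum]
    linarith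
  · intro k hk x
    have hbdd : BddBelow (Set.range fun z => W ((s k).piecewise z x)) :=
      ⟨0, by rintro _ ⟨z, rfl⟩; exact h.nonneg _⟩
    have : Nonempty (ι → 𝒳) := ⟨x⟩
    -- Taking the infimum over the block makes `u` independent of the block's coordinates and puts
    -- `d` between `0` and `U k z`.
    refine ⟨Real.exp (t * ⨅ z, W ((s k).piecewise z x)), Real.exp_pos _, fun z hz => ?_⟩
    set c := ⨅ z, W ((s k).piecewise z x)
    have hc1 : c ≤ W z := by
      have : (s k).piecewise z x = z := by
        ext i
        by_cases hi : i ∈ s k <;> simp [hi, hz]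
      exact (ciInf_le hbdd z).trans_eq (by rw [this])
    have hc2 : W z - U k z ≤ c := le_ciInf fun y => by
      have := h.sub_le k hk z ((s k).piecewise y x) fun i hi => by simp [hi, hz]
      linarith
    have hd := htb k hk z (W z - c) (by linarith) (by linarith)
    rw [← Real.exp_sub, Real.log_exp]
    have e : Real.exp (t * c) = Real.exp (t * W z) * Real.exp (-(t * (W z - c))) := by
      rw [← Real.exp_add]; ring_nf
    rw [e]
    have := mul_le_mul_of_nonneg_left hd (Real.exp_pos (t * W z)).le
    linarith

theorem cgf_neg_le (h : IsBlockSelfBounding K s a W U) (hcover : K.biUnion s = Finset.univ)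
    (ha : 0 < a) {θ : ℝ} (hθ : 0 < θ) :
    cgf W (Measure.pi μ) (-θ)
      ≤ -((1 - Real.exp (-(θ * a))) / a * ∫ x, W x ∂(Measure.pi μ)) := by
  refine cgf_neg_le_of_entropy_le h.boundedMeasurable ha (fun θ hθ => ?_) hθ
  have hφ : 0 ≤ Real.exp (θ * a) - θ * a - 1 := by linarith [Real.add_one_le_exp (θ * a)]
  refine (h.entropy_exp_le (b := (Real.exp (θ * a) - θ * a - 1) / a ^ 2) hcover (by positivity)
    fun k hk x d hd hdU => ?_).trans_eq ?_
  · have h1 := exp_sub_le_sq_div (y := θ * d) (b := θ * a) (by positivity)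
      (mul_le_mul_of_nonneg_left (hdU.trans (h.osc_le k hk x)) hθ.le) (by positivity)
    have e : θ * d / (θ * a) = d / a := by field_simp
    rw [e] at h1
    have h2 : -θ * d - 1 + Real.exp (-(-θ * d)) = Real.exp (θ * d) - θ * d - 1 := by
      rw [neg_mul, neg_neg]; ring
    rw [h2]
    refine h1.trans ?_
    rw [div_pow, div_mul_eq_mul_div, mul_div_assoc]
    gcongr
  · field_simp

theorem cgf_le (h : IsBlockSelfBounding K s a W U) (hcover : K.biUnion s = Finset.univ)
    {θ : ℝ} (hθ : 0 < θ) (haθ : a / 2 * θ < 1) :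
    cgf W (Measure.pi μ) θ ≤ θ / (1 - a / 2 * θ) * ∫ x, W x ∂(Measure.pi μ) := by
  refine cgf_le_of_entropy_le h.boundedMeasurable (fun θ hθ => ?_) hθ haθ
  refine (h.entropy_exp_le (b := θ ^ 2 / 2) hcover (by positivity)
    fun k hk x d hd hdU => ?_).trans_eq (by ring)
  have h1 := exp_neg_add_sub_one_le (x := θ * d) (by positivity)
  have h2 : (θ * d) ^ 2 / 2 ≤ θ ^ 2 / 2 * U k x ^ 2 := by
    have := pow_le_pow_left₀ hd hdU 2
    nlinarith [sq_nonneg θ]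
  linarith

end IsBlockSelfBounding

end SelfBounding

/-! ### Sums over the orbits of an involution -/

section Involution

variable {ι : Type*} [Fintype ι] [LinearOrder ι] {τ : ι → ι}

/-- The condition `k ≤ τ k` selects one representative per orbit, so doubling counts each fixed
point once too often. -/
theorem two_mul_sum_le_involution (hτ : Function.Involutive τ) (h : ι → ℝ)
    (hh : ∀ k, h (τ k) = h k) :
    2 * ∑ k with k ≤ τ k, h k = ∑ k, h k + ∑ k with τ k = k, h k := by
  have h1 : ∑ k with τ k ≤ k, h k = ∑ k with k ≤ τ k, h k := by
    refine Finset.sum_nbij' τ τ ?_ ?_ ?_ ?_ ?_ <;> simp [hτ _, hh]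
  rw [two_mul]
  nth_rewrite 2 [← h1]
  simp only [Finset.sum_filter, ← Finset.sum_add_distrib]
  refine Finset.sum_congr rfl fun k _ => ?_
  rcases lt_trichotomy k (τ k) with hk | hk | hk
  · simp [hk.le, hk.not_ge, hk.ne']
  · simp [← hk]
  · simp [hk.le, hk.not_ge, hk.ne]

/-- The sum of `G` over the indices outside of the orbit of `k`. -/
def sumOffOrbit (τ : ι → ι) (G : ι → ℝ) (k : ι) : ℝ :=
  ∑ i with i ≠ k ∧ i ≠ τ k, G i

theorem sumOffOrbit_le {G : ι → ℝ} {n : ℕ} (hn : Fintype.card ι = n + 1) {M : ℝ} (hM : 0 ≤ M)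
    (hG : ∀ i, G i ≤ M) (k : ι) : sumOffOrbit τ G k ≤ n * M := by
  have h1 : (Finset.univ.filter fun i => i ≠ k ∧ i ≠ τ k).card ≤ n := by
    have : (Finset.univ.filter fun i => i ≠ k ∧ i ≠ τ k) ⊆ Finset.univ.erase k := by
      intro i; simp +contextual
    have := Finset.card_le_card this
    rwa [Finset.card_erase_of_mem (Finset.mem_univ _), Finset.card_univ, hn] at this
  calc sumOffOrbit τ G k ≤ (Finset.univ.filter fun i => i ≠ k ∧ i ≠ τ k).card • M :=
        Finset.sum_le_card_nsmul _ _ _ fun i _ => hG i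
    _ ≤ n * M := by
        rw [nsmul_eq_mul]
        gcongr

theorem sq_sum_le_card_moved_mul {G : ι → ℝ} (hfix : ∀ i, τ i = i → G i = 0) (T : Finset ι) :
    (∑ i ∈ T, G i) ^ 2 ≤ (T.filter fun i => τ i ≠ i).card * ∑ i, G i ^ 2 := by
  have h1 : ∑ i ∈ T, G i = ∑ i ∈ T.filter fun i => τ i ≠ i, G i := by
    rw [Finset.sum_filter]
    refine Finset.sum_congr rfl fun i _ => ?_
    by_cases hi : τ i = i <;> simp [hi, hfix]
  rw [h1]
  refine sq_sum_le_card_mul_sum_sq.trans ?_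
  gcongr
  exact Finset.subset_univ _

/-- Let `p` indices be moved and `r` fixed, and let `S` be the sum of squares of `G`. As `G`
vanishes at fixed points, Cauchy–Schwarz bounds the squared off-orbit sum by `(p - 2) * S` for moved
`k` and by `p * S` for fixed `k`. -/
theorem sum_sq_sumOffOrbit_le (hτ : Function.Involutive τ) {G : ι → ℝ}
    (hfix : ∀ i, τ i = i → G i = 0) {n : ℕ} (hn : Fintype.card ι = n + 1) :
    2 * ∑ k with k ≤ τ k, sumOffOrbit τ G k ^ 2 ≤ (n : ℝ) ^ 2 * ∑ i, G i ^ 2 := by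
  set p := (Finset.univ.filter fun i => τ i ≠ i).card with hp
  set r := (Finset.univ.filter fun i => τ i = i).card with hr
  set S := ∑ i, G i ^ 2 with hS
  have hS0 : 0 ≤ S := Finset.sum_nonneg fun i _ => sq_nonneg _
  have hpr : (p : ℝ) + r = n + 1 := by
    have := Finset.card_filter_add_card_filter_not (s := (Finset.univ : Finset ι)) (fun i => τ i = i)
    rw [Finset.card_univ, hn] at this
    have h2 : r + p = n + 1 := this
    exact_mod_cast (add_comm p r).trans h2
  have hinv : ∀ k, sumOffOrbit τ G (τ k) ^ 2 = sumOffOrbit τ G k ^ 2 := fun k => by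
    simp only [sumOffOrbit, hτ k]
    congr 2
    ext i
    simp [and_comm]
  have hfixed : ∀ k, sumOffOrbit τ G k ^ 2 ≤ p * S := fun k => by
    refine (sq_sum_le_card_moved_mul hfix _).trans (mul_le_mul_of_nonneg_right ?_ hS0)
    exact_mod_cast Finset.card_le_card (Finset.filter_subset_filter _ (Finset.subset_univ _))
  have hmoved : ∀ k, τ k ≠ k → sumOffOrbit τ G k ^ 2 ≤ (p - 2) * S := fun k hk => by
    refine (sq_sum_le_card_moved_mul hfix _).trans ?_
    gcongr
    have hsub : ({k, τ k} : Finset ι) ⊆ Finset.univ.filter fun i => τ i ≠ i := by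
      intro i hi
      rw [Finset.mem_insert, Finset.mem_singleton] at hi
      rcases hi with rfl | rfl
      · simpa using hk
      · simpa [hτ k] using hk.symm
    have heq : ((Finset.univ.filter fun i => i ≠ k ∧ i ≠ τ k).filter fun i => τ i ≠ i)
        = (Finset.univ.filter fun i => τ i ≠ i) \ {k, τ k} := by
      ext i
      simp
      tauto
    have h2 : ({k, τ k} : Finset ι).card = 2 := Finset.card_pair hk.symm
    have h3 := Finset.card_sdiff_add_card_eq_card hsub
    rw [heq, le_sub_iff_add_le]
    rw [h2] at h3
    exact_mod_cast h3.le
  rw [two_mul_sum_le_involution hτ _ hinv]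
  have hsum : ∑ k, sumOffOrbit τ G k ^ 2 ≤ p * ((p - 2) * S) + r * (p * S) := by
    rw [← Finset.sum_filter_add_sum_filter_not Finset.univ (fun k => τ k = k), add_comm]
    refine add_le_add ?_ ?_
    · refine (Finset.sum_le_card_nsmul _ _ _ fun k hk => hmoved k (by simpa using hk)).trans_eq ?_
      rw [nsmul_eq_mul]
    · refine (Finset.sum_le_card_nsmul _ _ _ fun k _ => hfixed k).trans_eq ?_
      rw [nsmul_eq_mul]
  have hsum' : ∑ k with τ k = k, sumOffOrbit τ G k ^ 2 ≤ r * (p * S) := by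
    refine (Finset.sum_le_card_nsmul _ _ _ fun k _ => hfixed k).trans_eq ?_
    rw [nsmul_eq_mul]
  have hr' : (r : ℝ) = n + 1 - p := by linarith
  rw [hr'] at hsum hsum'
  -- With `r = n + 1 - p`, the total coefficient is `p (p - 2) + 2 r p = n² - (n - p)²`.
  nlinarith [mul_nonneg (sq_nonneg ((p : ℝ) - n)) hS0]

/-- The constant `a` arises here from `(b + e)² ≤ 2b² + 2e²`: the own part satisfies `b² ≤ M² * b`
and the `b` sum to `W`, while the off-orbit parts cost at most `8J² * W`. -/
theorem sum_sq_osc_le (hτ : Function.Involutive τ) {G : ι → ℝ} (hG0 : ∀ i, 0 ≤ G i)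
    (hfix : ∀ i, τ i = i → G i = 0) {n : ℕ} (hn0 : n ≠ 0) (hn : Fintype.card ι = n + 1)
    {M : ℝ} (hG : ∀ i, G i ≤ M) (J : ℝ) :
    ∑ k with k ≤ τ k, ((G k ^ 2 + G (τ k) ^ 2) / 2 + 2 * J / n * sumOffOrbit τ G k) ^ 2
      ≤ (2 * M ^ 2 + 8 * J ^ 2) * ((∑ i, G i ^ 2) / 2) := by
  have hnR : (n : ℝ) ≠ 0 := by exact_mod_cast hn0
  have hGsq : ∀ i, G i ^ 2 ≤ M ^ 2 := fun i => pow_le_pow_left₀ (hG0 i) (hG i) 2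
  have hB : ∑ k with k ≤ τ k, (G k ^ 2 + G (τ k) ^ 2) / 2 = (∑ i, G i ^ 2) / 2 := by
    have h1 := two_mul_sum_le_involution hτ (fun k => (G k ^ 2 + G (τ k) ^ 2) / 2)
      fun k => by simp only [hτ k, add_comm]
    have h2 : ∑ k with τ k = k, (G k ^ 2 + G (τ k) ^ 2) / 2 = 0 := by
      refine Finset.sum_eq_zero fun k hk => ?_
      have hk' : τ k = k := by simpa using hk
      simp [hk', hfix]
    have h3 : ∑ k, G (τ k) ^ 2 = ∑ k, G k ^ 2 :=
      Equiv.sum_comp (hτ.toPerm τ) fun k => G k ^ 2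
    have h4 : ∑ k, (G k ^ 2 + G (τ k) ^ 2) / 2 = ∑ k, G k ^ 2 := by
      rw [← Finset.sum_div, Finset.sum_add_distrib, h3]
      ring
    rw [h2, h4] at h1
    linarith
  have hA := sum_sq_sumOffOrbit_le hτ hfix hn
  calc ∑ k with k ≤ τ k, ((G k ^ 2 + G (τ k) ^ 2) / 2 + 2 * J / n * sumOffOrbit τ G k) ^ 2
      ≤ ∑ k with k ≤ τ k, (2 * M ^ 2 * ((G k ^ 2 + G (τ k) ^ 2) / 2)
          + 8 * J ^ 2 / n ^ 2 * sumOffOrbit τ G k ^ 2) := by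
        refine Finset.sum_le_sum fun k _ => ?_
        set b := (G k ^ 2 + G (τ k) ^ 2) / 2 with hb
        have hb0 : 0 ≤ b := by positivity
        have hbM : b ≤ M ^ 2 := by linarith [hGsq k, hGsq (τ k)]
        have e : 8 * J ^ 2 / n ^ 2 * sumOffOrbit τ G k ^ 2
            = 2 * (2 * J / n * sumOffOrbit τ G k) ^ 2 := by field_simp; ring
        rw [e]
        nlinarith [sq_nonneg (b - 2 * J / n * sumOffOrbit τ G k),
          mul_le_mul_of_nonneg_left hbM hb0]
    _ = 2 * M ^ 2 * ((∑ i, G i ^ 2) / 2)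
          + 8 * J ^ 2 / n ^ 2 * ∑ k with k ≤ τ k, sumOffOrbit τ G k ^ 2 := by
        rw [Finset.sum_add_distrib, ← Finset.mul_sum, ← Finset.mul_sum, hB]
    _ ≤ 2 * M ^ 2 * ((∑ i, G i ^ 2) / 2)
          + 8 * J ^ 2 / n ^ 2 * ((n : ℝ) ^ 2 * (∑ i, G i ^ 2) / 2) := by
        gcongr
        linarith
    _ = _ := by field_simp

end Involution

/-! ### Differences in the estimator and the seminorms -/

section PairDiff

variable {𝒳 : Type*} {n : ℕ}

theorem delete_replace_succAbove (j : Fin (n + 1)) (p : Fin n) (y : 𝒳) (x : Fin (n + 1) → 𝒳) :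
    delete j (replace (j.succAbove p) y x) = replace p y (delete j x) := by
  ext i
  by_cases hi : i = p
  · subst hi; simp [delete, replace]
  · have : j.succAbove i ≠ j.succAbove p := fun h => hi (Fin.succAbove_right_injective h)
    simp [delete, replace, hi, this]

/-- The difference whose squares are summed in the variance estimator. -/
def pairDiff (f : (Fin n → 𝒳) → ℝ) (i j : Fin (n + 1)) (x : Fin (n + 1) → 𝒳) : ℝ :=
  f (delete j x) - f (delete j (replace i (x j) x))

theorem pairDiff_succAbove (f : (Fin n → 𝒳) → ℝ) (j : Fin (n + 1)) (p : Fin n)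
    (x : Fin (n + 1) → 𝒳) : pairDiff f (j.succAbove p) j x
      = partialDiff p (x (j.succAbove p)) (x j) f (delete j x) := by
  have : replace p (x (j.succAbove p)) (delete j x) = delete j x :=
    Function.update_eq_self p (delete j x)
  rw [pairDiff, partialDiff, delete_replace_succAbove, this]

variable {f : (Fin n → 𝒳) → ℝ} {C : ℝ}

theorem partialDiff_swap (k : Fin n) (y y' : 𝒳) (f : (Fin n → 𝒳) → ℝ) (x : Fin n → 𝒳) :
    partialDiff k y' y f x = -partialDiff k y y' f x := by
  simp [partialDiff]

theorem abs_partialDiff_le {f : (Fin n → 𝒳) → ℝ} (hC : ∀ x, |f x| ≤ C) (k : Fin n) (y y' : 𝒳)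
    (x : Fin n → 𝒳) : |partialDiff k y y' f x| ≤ 2 * C := by
  have h1 := abs_sub (f (replace k y x)) (f (replace k y' x))
  have h2 := hC (replace k y x)
  have h3 := hC (replace k y' x)
  unfold partialDiff
  linarith

theorem abs_partialDiff_le_seminormM (hC : ∀ x, |f x| ≤ C) (k : Fin n) (y y' : 𝒳)
    (x : Fin n → 𝒳) : |partialDiff k y y' f x| ≤ seminormM f := by
  have hbdd : BddAbove (Set.range fun p : Fin n × (Fin n → 𝒳) × 𝒳 × 𝒳 =>
      partialDiff p.1 p.2.2.1 p.2.2.2 f p.2.1) := by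
    refine ⟨2 * C, ?_⟩
    rintro _ ⟨p, rfl⟩
    exact (le_abs_self _).trans (abs_partialDiff_le hC _ _ _ _)
  rw [abs_le']
  refine ⟨le_ciSup hbdd (k, x, y, y'), ?_⟩
  rw [← partialDiff_swap]
  exact le_ciSup hbdd (k, x, y', y)

theorem abs_partialDiff_partialDiff_le_seminormJ (hn : n ≠ 0) (hC : ∀ x, |f x| ≤ C)
    {l k : Fin n} (hlk : l ≠ k) (z z' y y' : 𝒳) (x : Fin n → 𝒳) :
    |partialDiff l z z' (partialDiff k y y' f) x| ≤ seminormJ f / n := by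
  have hbdd : BddAbove (Set.range fun p : {q : Fin n × Fin n // q.1 ≠ q.2} × (Fin n → 𝒳) ×
      (𝒳 × 𝒳) × (𝒳 × 𝒳) => partialDiff p.1.1.1 p.2.2.1.1 p.2.2.1.2
      (partialDiff p.1.1.2 p.2.2.2.1 p.2.2.2.2 f) p.2.1) := by
    refine ⟨2 * (2 * C), ?_⟩
    rintro _ ⟨p, rfl⟩
    exact (le_abs_self _).trans (abs_partialDiff_le (abs_partialDiff_le hC _ _ _) _ _ _ _)
  have hnR : (n : ℝ) ≠ 0 := by exact_mod_cast hn
  rw [seminormJ, mul_div_cancel_left₀ _ hnR, abs_le']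
  refine ⟨le_ciSup hbdd (⟨(l, k), hlk⟩, x, (z, z'), (y, y')), ?_⟩
  rw [← partialDiff_swap]
  exact le_ciSup hbdd (⟨(l, k), hlk⟩, x, (z', z), (y, y'))

theorem seminormM_nonneg [Nonempty 𝒳] (hn : n ≠ 0) (hC : ∀ x, |f x| ≤ C) : 0 ≤ seminormM f := by
  obtain ⟨y⟩ := ‹Nonempty 𝒳›
  exact (abs_nonneg _).trans
    (abs_partialDiff_le_seminormM hC ⟨0, Nat.pos_of_ne_zero hn⟩ y y fun _ => y)

theorem seminormJ_nonneg [Nonempty 𝒳] (hn : 2 ≤ n) (hC : ∀ x, |f x| ≤ C) : 0 ≤ seminormJ f := by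
  obtain ⟨y⟩ := ‹Nonempty 𝒳›
  have h := (abs_nonneg _).trans (abs_partialDiff_partialDiff_le_seminormJ (by omega) hC
    (l := ⟨0, by omega⟩) (k := ⟨1, by omega⟩) (by simp) y y y y fun _ => y)
  have hnR : (0 : ℝ) < n := by exact_mod_cast (by omega : 0 < n)
  have := mul_nonneg h hnR.le
  rwa [div_mul_cancel₀ _ hnR.ne'] at this

theorem abs_pairDiff_le (hC : ∀ x, |f x| ≤ C) {i j : Fin (n + 1)} (hij : i ≠ j)
    (x : Fin (n + 1) → 𝒳) : |pairDiff f i j x| ≤ seminormM f := by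
  obtain ⟨p, rfl⟩ := Fin.exists_succAbove_eq hij
  rw [pairDiff_succAbove]
  exact abs_partialDiff_le_seminormM hC _ _ _ _

/-- For fixed `x i` and `x j` the pair difference is a partial difference of `f`, so moving a third
coordinate produces a mixed second difference. -/
theorem abs_pairDiff_sub_replace_le (hn : n ≠ 0) (hC : ∀ x, |f x| ≤ C) {i j l : Fin (n + 1)}
    (hij : i ≠ j) (hli : l ≠ i) (hlj : l ≠ j) (y : 𝒳) (x : Fin (n + 1) → 𝒳) :
    |pairDiff f i j x - pairDiff f i j (replace l y x)| ≤ seminormJ f / n := by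
  obtain ⟨p, rfl⟩ := Fin.exists_succAbove_eq hij
  obtain ⟨q, rfl⟩ := Fin.exists_succAbove_eq hlj
  have hqp : q ≠ p := fun h => hli (by rw [h])
  have h1 : replace (j.succAbove q) y x j = x j := by simp [replace, Fin.ne_succAbove]
  have h2 : replace (j.succAbove q) y x (j.succAbove p) = x (j.succAbove p) := by
    simp [replace, hli.symm]
  have h3 : replace q (x (j.succAbove q)) (delete j x) = delete j x :=
    Function.update_eq_self q (delete j x)
  rw [pairDiff_succAbove, pairDiff_succAbove, h1, h2, delete_replace_succAbove]
  have := abs_partialDiff_partialDiff_le_seminormJ hn hC hqp (x (j.succAbove q)) y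
    (x (j.succAbove p)) (x j) (delete j x)
  rwa [partialDiff, h3] at this

theorem abs_pairDiff_sub_le (hn : n ≠ 0) (hC : ∀ x, |f x| ≤ C) {i j k l : Fin (n + 1)}
    (hij : i ≠ j) (hki : k ≠ i) (hkj : k ≠ j) (hli : l ≠ i) (hlj : l ≠ j)
    {x y : Fin (n + 1) → 𝒳} (hxy : ∀ m, m ≠ k → m ≠ l → y m = x m) :
    |pairDiff f i j x - pairDiff f i j y| ≤ 2 * seminormJ f / n := by
  have hy : y = replace l (y l) (replace k (y k) x) := by
    ext m
    by_cases hml : m = l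
    · subst hml; simp [replace]
    · by_cases hmk : m = k
      · subst hmk; simp [replace, hml]
      · simp [replace, hml, hmk, hxy]
  have h1 := abs_pairDiff_sub_replace_le hn hC hij hki hkj (y k) x
  have h2 := abs_pairDiff_sub_replace_le hn hC hij hli hlj (y l) (replace k (y k) x)
  rw [← hy] at h2
  have := abs_sub_le (pairDiff f i j x) (pairDiff f i j (replace k (y k) x)) (pairDiff f i j y)
  have e : 2 * seminormJ f / n = seminormJ f / n + seminormJ f / n := by ring
  rw [e]
  exact this.trans (add_le_add h1 h2)

end PairDiff

/-! ### Measurability of deletion and replacement -/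

section Measurability

variable {𝒳 : Type*} [MeasurableSpace 𝒳] {n : ℕ}

theorem measurable_delete (j : Fin (n + 1)) :
    Measurable (delete j : (Fin (n + 1) → 𝒳) → Fin n → 𝒳) :=
  measurable_pi_lambda _ fun i => measurable_pi_apply (j.succAbove i)

theorem measurable_replace_pair (k : Fin n) :
    Measurable fun p : 𝒳 × (Fin n → 𝒳) => replace k p.1 p.2 := by
  refine measurable_pi_lambda _ fun i => ?_
  by_cases hi : i = k
  · subst hi
    simpa [replace] using measurable_fst
  · simpa [replace, hi, Function.comp_def] using (measurable_pi_apply i).comp measurable_snd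

variable {f : (Fin n → 𝒳) → ℝ}

theorem BoundedMeasurable.pairDiff (hf : BoundedMeasurable f) (i j : Fin (n + 1)) :
    BoundedMeasurable (pairDiff f i j) :=
  (hf.comp (measurable_delete j)).sub (hf.comp ((measurable_delete j).comp
    ((measurable_replace_pair i).comp ((measurable_pi_apply j).prodMk measurable_id))))

end Measurability

/-! ### Splitting the estimator along the matchings `i ↦ c - i` -/

section MatchedVariance

variable {𝒳 : Type*} {n : ℕ}

/-- The size of the difference attached to `i` and its partner `c - i`, zero if `i` is its own
partner. -/
noncomputable def matchedDiff (f : (Fin n → 𝒳) → ℝ) (c i : Fin (n + 1)) (x : Fin (n + 1) → 𝒳) : ℝ :=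
  if c - i = i then 0 else |pairDiff f i (c - i) x|

/-- The part of the variance estimator that comes from the matching `i ↦ c - i`. -/
noncomputable def matchedVariance (f : (Fin n → 𝒳) → ℝ) (c : Fin (n + 1)) (x : Fin (n + 1) → 𝒳) : ℝ :=
  (∑ i, matchedDiff f c i x ^ 2) / 2

/-- A bound for the decrease of `matchedVariance` when the coordinates `k` and `c - k` change. -/
noncomputable def matchedOsc (f : (Fin n → 𝒳) → ℝ) (c k : Fin (n + 1)) (x : Fin (n + 1) → 𝒳) : ℝ :=
  (matchedDiff f c k x ^ 2 + matchedDiff f c (c - k) x ^ 2) / 2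
    + 2 * seminormJ f / n * sumOffOrbit (c - ·) (fun i => matchedDiff f c i x) k

variable {f : (Fin n → 𝒳) → ℝ} {C : ℝ}

theorem involutive_sub_left {A : Type*} [AddCommGroup A] (c : A) :
    Function.Involutive (c - · : A → A) := fun i => sub_sub_self c i

theorem matchedDiff_nonneg (c i : Fin (n + 1)) (x : Fin (n + 1) → 𝒳) :
    0 ≤ matchedDiff f c i x := by
  unfold matchedDiff
  split_ifs
  exacts [le_rfl, abs_nonneg _]

theorem matchedDiff_eq_zero {c i : Fin (n + 1)} (h : c - i = i) (x : Fin (n + 1) → 𝒳) :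
    matchedDiff f c i x = 0 := if_pos h

theorem matchedDiff_le [Nonempty 𝒳] (hn : n ≠ 0) (hC : ∀ x, |f x| ≤ C) (c i : Fin (n + 1))
    (x : Fin (n + 1) → 𝒳) : matchedDiff f c i x ≤ seminormM f := by
  unfold matchedDiff
  split_ifs with h
  exacts [seminormM_nonneg hn hC, abs_pairDiff_le hC (Ne.symm h) x]

theorem matchedDiff_sub_le (hn : n ≠ 0) (hC : ∀ x, |f x| ≤ C) (hJ : 0 ≤ seminormJ f)
    {c i k : Fin (n + 1)} (hik : i ≠ k) (hik' : i ≠ c - k) {x y : Fin (n + 1) → 𝒳}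
    (hxy : ∀ m, m ≠ k → m ≠ c - k → y m = x m) :
    matchedDiff f c i x - matchedDiff f c i y ≤ 2 * seminormJ f / n := by
  unfold matchedDiff
  split_ifs with h
  · rw [sub_zero]; positivity
  · refine (abs_sub_abs_le_abs_sub _ _).trans
      (abs_pairDiff_sub_le hn hC (Ne.symm h) hik.symm ?_ hik'.symm ?_ hxy)
    · intro h'
      exact hik' (by rw [h', sub_sub_self])
    · intro h'
      exact hik (sub_right_injective h').symm

theorem matchedVariance_sub_le (hn : n ≠ 0) (hC : ∀ x, |f x| ≤ C) (hJ : 0 ≤ seminormJ f)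
    (c k : Fin (n + 1)) {x y : Fin (n + 1) → 𝒳}
    (hxy : ∀ m, m ≠ k → m ≠ c - k → y m = x m) :
    matchedVariance f c x - matchedVariance f c y ≤ matchedOsc f c k x := by
  have hJn : 0 ≤ 2 * seminormJ f / n := by positivity
  have key : ∀ i, matchedDiff f c i x ^ 2 - matchedDiff f c i y ^ 2
      ≤ (if i ≠ k ∧ i ≠ c - k then 2 * (2 * seminormJ f / n) * matchedDiff f c i x else 0)
        + ((if i = k then matchedDiff f c i x ^ 2 else 0)
        + (if i = c - k then matchedDiff f c i x ^ 2 else 0)) := fun i => by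
    by_cases h1 : i = k
    · have : (0 : ℝ) ≤ if i = c - k then matchedDiff f c i x ^ 2 else 0 := by positivity
      simp only [h1, ne_eq, not_true_eq_false, false_and, if_false, if_true] at this ⊢
      linarith [sq_nonneg (matchedDiff f c k y)]
    · by_cases h2 : i = c - k
      · simp only [h2, ne_eq, not_true_eq_false, and_false, if_false, if_true]
        rw [← h2]
        simp only [h1, if_false]
        linarith [sq_nonneg (matchedDiff f c i y)]
      · simp only [h1, h2, ne_eq, not_false_eq_true, and_self, if_false, if_true]
        -- Off the block, `G² - G'² ≤ 2 G (G - G')`; only the value at `x` remains, as self-bounding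
        -- requires.
        have h3 := matchedDiff_sub_le hn hC hJ h1 h2 hxy
        nlinarith [sq_nonneg (matchedDiff f c i x - matchedDiff f c i y),
          mul_le_mul_of_nonneg_left h3 (matchedDiff_nonneg (f := f) c i x)]
  have hsum := Finset.sum_le_sum fun i (_ : i ∈ Finset.univ) => key i
  rw [Finset.sum_sub_distrib, Finset.sum_add_distrib, Finset.sum_add_distrib,
    ← Finset.sum_filter, ← Finset.mul_sum, Finset.sum_ite_eq' Finset.univ k,
    Finset.sum_ite_eq' Finset.univ (c - k)] at hsum
  simp only [Finset.mem_univ, if_true] at hsum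
  unfold matchedVariance matchedOsc sumOffOrbit
  linarith

theorem matchedOsc_le [Nonempty 𝒳] (hn : 2 ≤ n) (hC : ∀ x, |f x| ≤ C) (c k : Fin (n + 1))
    (x : Fin (n + 1) → 𝒳) :
    matchedOsc f c k x ≤ 2 * seminormM f ^ 2 + 8 * seminormJ f ^ 2 := by
  have hn0 : n ≠ 0 := by omega
  have hnR : (0 : ℝ) < n := by exact_mod_cast (by omega : 0 < n)
  have hM := seminormM_nonneg hn0 hC
  have hJ := seminormJ_nonneg hn hC
  have h0 := matchedDiff_nonneg (f := f) c
  have hle := matchedDiff_le hn0 hC c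
  have hsq : ∀ i, matchedDiff f c i x ^ 2 ≤ seminormM f ^ 2 := fun i =>
    pow_le_pow_left₀ (h0 i x) (hle i x) 2
  have hoff := sumOffOrbit_le (τ := (c - ·)) (G := fun i => matchedDiff f c i x)
    (Fintype.card_fin _) hM (fun i => hle i x) k
  have h1 := mul_le_mul_of_nonneg_left hoff (by positivity : 0 ≤ 2 * seminormJ f / n)
  have h2 : 2 * seminormJ f / n * (n * seminormM f) = 2 * seminormJ f * seminormM f := by
    field_simp
  unfold matchedOsc
  nlinarith [hsq k, hsq (c - k), sq_nonneg (seminormJ f - seminormM f), sq_nonneg (seminormJ f)]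

theorem varEstimator_eq_average (f : (Fin n → 𝒳) → ℝ) (x : Fin (n + 1) → 𝒳) :
    varEstimator f x = ∑ c : Fin (n + 1), (1 / ((n : ℝ) + 1)) * matchedVariance f c x := by
  have h : ∀ c j, (if c - j ≠ j then pairDiff f j (c - j) x ^ 2 else 0)
      = matchedDiff f c j x ^ 2 := fun c j => by
    by_cases hj : c - j = j <;> simp [matchedDiff, hj]
  have e : ∑ c : Fin (n + 1), ∑ i, matchedDiff f c i x ^ 2
      = ∑ j : Fin (n + 1), ∑ i ∈ Finset.univ.erase j,
        (f (delete j x) - f (delete j (replace i (x j) x))) ^ 2 := by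
    simp only [← h]
    rw [Finset.sum_comm]
    conv_rhs =>
      enter [2, j]
      rw [← Finset.filter_ne' Finset.univ j, Finset.sum_filter]
    rw [Finset.sum_comm (s := Finset.univ) (t := Finset.univ)
      (f := fun j i => if i ≠ j then
        (f (delete j x) - f (delete j (replace i (x j) x))) ^ 2 else 0)]
    refine Finset.sum_congr rfl fun i _ => ?_
    -- For fixed `i`, the map `c ↦ c - i` is a bijection onto the possible partners `j`.
    rw [← Equiv.sum_comp (Equiv.subRight i) fun j => if i ≠ j then
        (f (delete j x) - f (delete j (replace i (x j) x))) ^ 2 else 0]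
    refine Finset.sum_congr rfl fun c _ => ?_
    simp [pairDiff, eq_comm]
  unfold varEstimator
  rw [← e, ← Finset.mul_sum]
  unfold matchedVariance
  rw [← Finset.sum_div]
  field_simp

variable [MeasurableSpace 𝒳]

theorem BoundedMeasurable.matchedDiff (hf : BoundedMeasurable f) (c i : Fin (n + 1)) :
    BoundedMeasurable (matchedDiff f c i) := by
  unfold WeakInteraction.matchedDiff
  split_ifs
  exacts [.const 0, (hf.pairDiff i _).abs]

theorem BoundedMeasurable.matchedVariance (hf : BoundedMeasurable f) (c : Fin (n + 1)) :
    BoundedMeasurable (matchedVariance f c) := by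
  have := (BoundedMeasurable.sum Finset.univ
    fun i _ => (hf.matchedDiff c i).pow 2).const_mul (1 / 2)
  simp only [one_div, inv_mul_eq_div] at this
  exact this

theorem BoundedMeasurable.varEstimator (hf : BoundedMeasurable f) :
    BoundedMeasurable (varEstimator f) := by
  have := BoundedMeasurable.sum Finset.univ
    fun c (_ : c ∈ Finset.univ) => (hf.matchedVariance c).const_mul (1 / ((n : ℝ) + 1))
  simpa only [← varEstimator_eq_average] using this

theorem BoundedMeasurable.matchedOsc (hf : BoundedMeasurable f) (c k : Fin (n + 1)) :
    BoundedMeasurable (matchedOsc f c k) := by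
  have h1 := (((hf.matchedDiff c k).pow 2).add ((hf.matchedDiff c (c - k)).pow 2)).const_mul (1 / 2)
  have h2 := (BoundedMeasurable.sum (Finset.univ.filter fun i => i ≠ k ∧ i ≠ c - k)
    fun i _ => hf.matchedDiff c i).const_mul (2 * seminormJ f / n)
  have := h1.add h2
  simp only [one_div, inv_mul_eq_div] at this
  exact this

theorem isBlockSelfBounding_matchedVariance [Nonempty 𝒳] (hn : 2 ≤ n)
    (hf : BoundedMeasurable f) (c : Fin (n + 1)) :
    IsBlockSelfBounding (Finset.univ.filter fun k => k ≤ c - k) (fun k => {k, c - k})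
      (2 * seminormM f ^ 2 + 8 * seminormJ f ^ 2) (matchedVariance f c) (matchedOsc f c) := by
  obtain ⟨C, hC⟩ := hf.2
  have hn0 : n ≠ 0 := by omega
  refine ⟨hf.matchedVariance c, fun k _ => hf.matchedOsc c k, fun x => ?_,
    fun k _ => matchedOsc_le hn hC c k, fun k _ x y hxy => ?_, fun x => ?_⟩
  · unfold matchedVariance; positivity
  · exact matchedVariance_sub_le hn0 hC (seminormJ_nonneg hn hC) c k fun m hm hm' =>
      hxy m (by simp [hm, hm'])
  · exact sum_sq_osc_le (involutive_sub_left c) (fun i => matchedDiff_nonneg c i x)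
      (fun i hi => matchedDiff_eq_zero hi x) hn0 (Fintype.card_fin _)
      (fun i => matchedDiff_le hn0 hC c i x) _

theorem biUnion_orbits (c : Fin (n + 1)) :
    (Finset.univ.filter fun k => k ≤ c - k).biUnion (fun k => {k, c - k}) = Finset.univ := by
  ext i
  simp only [Finset.mem_biUnion, Finset.mem_filter, Finset.mem_univ, true_and,
    Finset.mem_insert, Finset.mem_singleton, iff_true]
  rcases le_total i (c - i) with h | h
  · exact ⟨i, h, .inl rfl⟩
  · exact ⟨c - i, by rwa [sub_sub_self], .inr (sub_sub_self c i).symm⟩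

end MatchedVariance

/-! ### Exponential moments of a convex combination -/

section Average

variable {Ω : Type*} [MeasurableSpace Ω] {P : Measure Ω} [IsProbabilityMeasure P]

/-- Jensen is applied to the normalised exponents `t * W k - r * E[W k]`, each of exponential mean
at most `1`. This handles unequal means and needs no independence. -/
theorem mgf_average_le {κ : Type*} (K : Finset κ) {w : κ → ℝ} (hw : ∀ k ∈ K, 0 ≤ w k)
    (hw1 : ∑ k ∈ K, w k = 1) {W : κ → Ω → ℝ} (hW : ∀ k ∈ K, BoundedMeasurable (W k)) {t r : ℝ}
    (h : ∀ k ∈ K, cgf (W k) P t ≤ r * ∫ ω, W k ω ∂P) :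
    mgf (fun ω => ∑ k ∈ K, w k * W k ω) P t ≤ Real.exp (r * ∫ ω, ∑ k ∈ K, w k * W k ω ∂P) := by
  set e : κ → ℝ := fun k => ∫ ω, W k ω ∂P with he
  have hmean : ∫ ω, ∑ k ∈ K, w k * W k ω ∂P = ∑ k ∈ K, w k * e k := by
    rw [integral_finsetSum _ fun k hk => ((hW k hk).const_mul _).integrable _]
    exact Finset.sum_congr rfl fun k _ => integral_const_mul _ _
  rw [hmean]
  set E := ∑ k ∈ K, w k * e k
  have hb : ∀ k ∈ K, BoundedMeasurable fun ω => w k * (Real.exp (-(r * e k)) * Real.exp (t * W k ω)) :=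
    fun k hk => (((hW k hk).exp_mul t).const_mul _).const_mul _
  have hbW : BoundedMeasurable fun ω => ∑ k ∈ K, w k * W k ω :=
    BoundedMeasurable.sum K fun k hk => (hW k hk).const_mul _
  have hpt : ∀ ω, Real.exp (-(r * E)) * Real.exp (t * ∑ k ∈ K, w k * W k ω)
      ≤ ∑ k ∈ K, w k * (Real.exp (-(r * e k)) * Real.exp (t * W k ω)) := fun ω => by
    have := convexOn_exp.map_sum_le hw hw1 (p := fun k => -(r * e k) + t * W k ω)
      fun _ _ => Set.mem_univ _
    simp only [smul_eq_mul, Real.exp_add] at this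
    refine le_trans (le_of_eq ?_) this
    rw [← Real.exp_add]
    congr 1
    simp only [E, mul_add, Finset.sum_add_distrib, Finset.mul_sum, ← Finset.sum_neg_distrib]
    congr 1 <;> refine Finset.sum_congr rfl fun k _ => ?_ <;> ring
  have hint := integral_mono (μ := P) (((hbW.exp_mul t).const_mul _).integrable _)
    ((BoundedMeasurable.sum K hb).integrable _) hpt
  rw [integral_const_mul, integral_finsetSum _ fun k hk => (hb k hk).integrable _] at hint
  have hone : ∑ k ∈ K, ∫ ω, w k * (Real.exp (-(r * e k)) * Real.exp (t * W k ω)) ∂P ≤ 1 := by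
    rw [← hw1]
    refine Finset.sum_le_sum fun k hk => ?_
    rw [integral_const_mul, integral_const_mul]
    have h1 : mgf (W k) P t ≤ Real.exp (r * e k) := by
      rw [← exp_cgf (((hW k hk).exp_mul t).integrable P)]
      exact Real.exp_le_exp.2 (h k hk)
    have h2 : Real.exp (-(r * e k)) * mgf (W k) P t ≤ 1 := by
      refine (mul_le_mul_of_nonneg_left h1 (Real.exp_pos _).le).trans_eq ?_
      rw [← Real.exp_add]
      simp
    exact mul_le_of_le_one_right (hw k hk) h2
  have h3 : Real.exp (-(r * E)) * mgf (fun ω => ∑ k ∈ K, w k * W k ω) P t ≤ 1 := hint.trans hone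
  rw [Real.exp_neg, inv_mul_le_iff₀ (Real.exp_pos _), mul_one] at h3
  exact h3

end Average

/-! ### Unbiasedness of the estimator -/

section Mean

variable {𝒳 : Type*} [MeasurableSpace 𝒳] {n : ℕ} (μ : Measure 𝒳) [IsProbabilityMeasure μ]

theorem measurePreserving_replace (k : Fin n) :
    MeasurePreserving (fun p : 𝒳 × (Fin n → 𝒳) => replace k p.1 p.2)
      (μ.prod (Measure.pi fun _ => μ)) (Measure.pi fun _ => μ) := by
  refine ⟨measurable_replace_pair k, (Measure.pi_eq fun t ht => ?_).symm⟩
  rw [Measure.map_apply (measurable_replace_pair k) (MeasurableSet.univ_pi ht)]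
  have hpre : (fun p : 𝒳 × (Fin n → 𝒳) => replace k p.1 p.2) ⁻¹' Set.univ.pi t
      = t k ×ˢ (Set.univ.pi fun i => if i = k then Set.univ else t i) := by
    ext p
    simp only [Set.mem_preimage, Set.mem_pi, Set.mem_univ, true_imp_iff, Set.mem_prod, replace]
    constructor
    · intro h
      refine ⟨by simpa using h k, fun i => ?_⟩
      by_cases hi : i = k
      · simp [hi]
      · simpa [hi] using h i
    · rintro ⟨h1, h2⟩ i
      by_cases hi : i = k
      · subst hi; simpa using h1
      · simpa [hi] using h2 i
  rw [hpre, Measure.prod_prod, Measure.pi_pi,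
    ← Finset.mul_prod_erase _ _ (Finset.mem_univ k),
    ← Finset.mul_prod_erase _ (fun i => μ (t i)) (Finset.mem_univ k)]
  simp only [if_true, measure_univ, one_mul]
  congr 1
  refine Finset.prod_congr rfl fun i hi => ?_
  rw [if_neg (Finset.ne_of_mem_erase hi)]

variable {μ} {f : (Fin n → 𝒳) → ℝ}

theorem BoundedMeasurable.sq_partialDiff (hf : BoundedMeasurable f) (k : Fin n) :
    BoundedMeasurable fun q : (𝒳 × 𝒳) × (Fin n → 𝒳) =>
      partialDiff k q.1.1 q.1.2 f q.2 ^ 2 := by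
  have h1 : Measurable fun q : (𝒳 × 𝒳) × (Fin n → 𝒳) => replace k q.1.1 q.2 :=
    (measurable_replace_pair k).comp ((measurable_fst.comp measurable_fst).prodMk measurable_snd)
  have h2 : Measurable fun q : (𝒳 × 𝒳) × (Fin n → 𝒳) => replace k q.1.2 q.2 :=
    (measurable_replace_pair k).comp ((measurable_snd.comp measurable_fst).prodMk measurable_snd)
  exact ((hf.comp h1).sub (hf.comp h2)).pow 2

theorem integral_condVar (hf : BoundedMeasurable f) (k : Fin n) :
    2 * ∫ x, condVar (fun _ => μ) k f x ∂(Measure.pi fun _ : Fin n => μ)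
      = ∫ q, partialDiff k q.1.1 q.1.2 f q.2 ^ 2
        ∂((μ.prod μ).prod (Measure.pi fun _ : Fin n => μ)) := by
  rw [integral_prod_symm _ ((hf.sq_partialDiff k).integrable _)]
  unfold condVar
  rw [integral_const_mul]
  ring

/-- The deleted observation `x j` is an independent copy of the coordinate it replaces, so the
squared difference has the mean of a squared `D^k` at two independent points. -/
theorem integral_sq_pairDiff (hf : BoundedMeasurable f) (j : Fin (n + 1)) (k : Fin n) :
    ∫ x, pairDiff f (j.succAbove k) j x ^ 2 ∂(Measure.pi fun _ : Fin (n + 1) => μ)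
      = 2 * ∫ x, condVar (fun _ => μ) k f x ∂(Measure.pi fun _ : Fin n => μ) := by
  rw [integral_condVar hf]
  have h1 := measurePreserving_piFinSuccAbove (fun _ : Fin (n + 1) => μ) j
  have h2 : ∀ x : Fin (n + 1) → 𝒳, pairDiff f (j.succAbove k) j x ^ 2
      = (fun q : 𝒳 × (Fin n → 𝒳) => (f q.2 - f (replace k q.1 q.2)) ^ 2)
        (MeasurableEquiv.piFinSuccAbove (fun _ => 𝒳) j x) := fun x => by
    rw [pairDiff, delete_replace_succAbove]
    rfl
  simp only [h2]
  rw [h1.integral_comp' (g := fun q : 𝒳 × (Fin n → 𝒳) => (f q.2 - f (replace k q.1 q.2)) ^ 2)]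
  -- Resampling coordinate `k` of the remaining vector keeps its law and supplies the second point;
  -- the order of the two points is lost in the square.
  have h3 := ((MeasurePreserving.id μ).prod (measurePreserving_replace μ k)).comp
    (measurePreserving_prodAssoc μ μ (Measure.pi fun _ : Fin n => μ))
  have hm : Measurable fun q : 𝒳 × (Fin n → 𝒳) => (f q.2 - f (replace k q.1 q.2)) ^ 2 :=
    ((hf.1.comp measurable_snd).sub (hf.1.comp (measurable_replace_pair k))).pow_const 2
  rw [← h3.map_eq, integral_map h3.measurable.aemeasurable hm.aestronglyMeasurable]
  refine integral_congr_ae (.of_forall fun q => ?_)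
  simp [partialDiff, replace, MeasurableEquiv.prodAssoc]
  ring

theorem integral_varEstimator (hf : BoundedMeasurable f) :
    ∫ x, varEstimator f x ∂(Measure.pi fun _ : Fin (n + 1) => μ)
      = ∫ x, sumCondVar (fun _ => μ) f x ∂(Measure.pi fun _ : Fin n => μ) := by
  have h1 : ∀ x, varEstimator f x = 1 / (2 * ((n : ℝ) + 1)) *
      ∑ j : Fin (n + 1), ∑ k : Fin n, pairDiff f (j.succAbove k) j x ^ 2 := fun x => by
    unfold varEstimator
    congr 1
    refine Finset.sum_congr rfl fun j _ => ?_
    have := Fin.sum_univ_succAbove (fun i => pairDiff f i j x ^ 2) j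
    rw [← Finset.add_sum_erase _ _ (Finset.mem_univ j)] at this
    exact add_left_cancel this
  have hp : ∀ (j : Fin (n + 1)) (k : Fin n),
      BoundedMeasurable fun x => pairDiff f (j.succAbove k) j x ^ 2 :=
    fun j k => (hf.pairDiff _ _).pow 2
  have hc : ∀ k : Fin n, Integrable (condVar (fun _ => μ) k f) (Measure.pi fun _ : Fin n => μ) :=
    fun k => (((hf.sq_partialDiff k).integrable
      ((μ.prod μ).prod (Measure.pi fun _ : Fin n => μ))).integral_prod_right).const_mul (1 / 2)
  simp only [h1]
  rw [integral_const_mul,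
    integral_finsetSum _ fun j _ => (BoundedMeasurable.sum _ fun k _ => hp j k).integrable _]
  simp only [fun j => integral_finsetSum (μ := Measure.pi fun _ : Fin (n + 1) => μ)
    Finset.univ fun k _ => (hp j k).integrable _, integral_sq_pairDiff hf]
  unfold sumCondVar
  rw [integral_finsetSum _ fun k _ => hc k]
  simp only [Finset.sum_const, Finset.card_univ, Fintype.card_fin, nsmul_eq_mul,
    ← Finset.mul_sum]
  push_cast
  field_simp

end Mean

/-! ### Chernoff bounds on the square-root scale -/

section Tails

variable {Ω : Type*} [MeasurableSpace Ω] {P : Measure Ω} [IsProbabilityMeasure P] {Z : Ω → ℝ}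

theorem measureReal_lt_sqrt_sub_sqrt_le (hZ : BoundedMeasurable Z)
    {a E : ℝ} (ha : 0 < a) (hE : 0 ≤ E)
    (hmgf : ∀ θ > 0, mgf Z P (-θ) ≤ Real.exp (-((1 - Real.exp (-(θ * a))) / a * E)))
    {t : ℝ} (ht : 0 < t) :
    P.real {ω | t < √E - √(Z ω)} ≤ Real.exp (-(t ^ 2 / a)) := by
  rcases le_or_gt (√E - t) 0 with hq | hq
  · have : {ω | t < √E - √(Z ω)} = ∅ := by
      ext ω
      simp only [Set.mem_ofPred_eq, Set.mem_empty_iff_false, iff_false, not_lt]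
      linarith [Real.sqrt_nonneg (Z ω)]
    rw [this]
    simpa using (Real.exp_pos _).le
  set p := √E with hp
  set q := p - t with hq'
  have hp0 : 0 < p := by linarith
  have hpE : E = p ^ 2 := (Real.sq_sqrt hE).symm
  have hlog : 0 < Real.log (p / q) := Real.log_pos ((one_lt_div hq).2 (by linarith))
  -- This makes `exp (-(θ * a)) = q / p`; then `log x ≤ x - 1` turns the exponent into exactly `-(p
  -- - q)² / a`.
  set θ := Real.log (p / q) / a with hθ
  have hθ0 : 0 < θ := by positivity
  have hsub : {ω | t < p - √(Z ω)} ⊆ {ω | Z ω ≤ q ^ 2} := fun ω hω => by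
    have hω' : √(Z ω) ≤ q := by
      have : t < p - √(Z ω) := hω
      linarith
    exact (Real.sqrt_le_left hq.le).1 hω'
  refine (measureReal_mono hsub).trans ((measure_le_le_exp_mul_mgf (q ^ 2) (t := -θ)
    (by linarith) ((hZ.exp_mul (-θ)).integrable P)).trans ?_)
  refine (mul_le_mul_of_nonneg_left (hmgf θ hθ0) (Real.exp_pos _).le).trans ?_
  rw [← Real.exp_add, Real.exp_le_exp]
  have h1 : Real.exp (-(θ * a)) = q / p := by
    rw [hθ, div_mul_cancel₀ _ ha.ne', Real.exp_neg, Real.exp_log (by positivity), inv_div]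
  have h2 : Real.log (p / q) ≤ p / q - 1 := Real.log_le_sub_one_of_pos (by positivity)
  have h3 : q ^ 2 * Real.log (p / q) ≤ q * p - q ^ 2 := by
    refine (mul_le_mul_of_nonneg_left h2 (sq_nonneg q)).trans_eq ?_
    field_simp
  have e : -(-θ) * q ^ 2 + -((1 - q / p) / a * p ^ 2)
      = (q ^ 2 * Real.log (p / q) - p ^ 2 + p * q) / a := by
    rw [hθ]
    field_simp
    ring
  have e2 : -(t ^ 2 / a) = ((q * p - q ^ 2) - p ^ 2 + p * q) / a := by
    rw [hq']
    field_simp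
    ring
  rw [h1, hpE, e, e2]
  gcongr

theorem measureReal_lt_sqrt_sub_sqrt_mean_le (hZ : BoundedMeasurable Z)
    {a E : ℝ} (ha : 0 < a) (hE : 0 ≤ E)
    (hmgf : ∀ θ > 0, a / 2 * θ < 1 → mgf Z P θ ≤ Real.exp (θ / (1 - a / 2 * θ) * E))
    {t : ℝ} (ht : 0 < t) :
    P.real {ω | t < √(Z ω) - √E} ≤ Real.exp (-(t ^ 2 / a)) := by
  set p := √E with hp
  have hp0 : 0 ≤ p := Real.sqrt_nonneg _
  have hpE : E = p ^ 2 := (Real.sq_sqrt hE).symm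
  -- This gives `1 - a / 2 * θ = (p + t / 2) / (p + t)`; lowering `p + t / 2` to `p` in the
  -- denominator bounds the exponent by `-θ (p + t) t = -t² / a`.
  set θ := t / (a * (p + t)) with hθ
  have hpt : 0 < p + t := by linarith
  have hθ0 : 0 < θ := by positivity
  have h1 : 1 - a / 2 * θ = (p + t / 2) / (p + t) := by
    rw [hθ]
    field_simp
    ring
  have hpos : 0 < (p + t / 2) / (p + t) := by positivity
  have hsub : {ω | t < √(Z ω) - p} ⊆ {ω | (p + t) ^ 2 ≤ Z ω} := fun ω hω => by
    have hω' : p + t < √(Z ω) := by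
      have : t < √(Z ω) - p := hω
      linarith
    exact (Real.lt_sqrt hpt.le).1 hω' |>.le
  refine (measureReal_mono hsub).trans ((measure_ge_le_exp_mul_mgf ((p + t) ^ 2) (t := θ)
    hθ0.le ((hZ.exp_mul θ).integrable P)).trans ?_)
  refine (mul_le_mul_of_nonneg_left (hmgf θ hθ0 (by linarith)) (Real.exp_pos _).le).trans ?_
  rw [← Real.exp_add, Real.exp_le_exp, h1, hpE]
  have h2 : θ / ((p + t / 2) / (p + t)) * p ^ 2 ≤ θ * (p + t) * p := by
    rw [div_div_eq_mul_div, div_mul_eq_mul_div, div_le_iff₀ (by positivity)]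
    have : p ^ 2 ≤ p * (p + t / 2) := by nlinarith
    nlinarith [mul_le_mul_of_nonneg_left this (by positivity : 0 ≤ θ * (p + t))]
  have h3 : -θ * (p + t) ^ 2 + θ * (p + t) * p = -(t ^ 2 / a) := by
    rw [hθ]
    field_simp
    ring
  linarith

end Tails

/-! ### Deviation bounds for the variance estimator -/

section VarEstimator

variable {𝒳 : Type*} [MeasurableSpace 𝒳] {n : ℕ} {μ : Measure 𝒳} [IsProbabilityMeasure μ]
  {f : (Fin n → 𝒳) → ℝ}

theorem sum_average_weights (n : ℕ) : ∑ _c : Fin (n + 1), 1 / ((n : ℝ) + 1) = 1 := by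
  simp only [Finset.sum_const, Finset.card_univ, Fintype.card_fin, nsmul_eq_mul]
  push_cast
  field_simp

theorem varEstimator_nonneg (f : (Fin n → 𝒳) → ℝ) (x : Fin (n + 1) → 𝒳) :
    0 ≤ varEstimator f x := by
  unfold varEstimator
  positivity

theorem mgf_varEstimator_le (hf : BoundedMeasurable f) {t r : ℝ}
    (h : ∀ c, cgf (matchedVariance f c) (Measure.pi fun _ : Fin (n + 1) => μ) t
      ≤ r * ∫ x, matchedVariance f c x ∂(Measure.pi fun _ : Fin (n + 1) => μ)) :
    mgf (varEstimator f) (Measure.pi fun _ : Fin (n + 1) => μ) t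
      ≤ Real.exp (r * ∫ x, sumCondVar (fun _ => μ) f x ∂(Measure.pi fun _ : Fin n => μ)) := by
  have := mgf_average_le (P := Measure.pi fun _ : Fin (n + 1) => μ) Finset.univ
    (w := fun _ => 1 / ((n : ℝ) + 1)) (fun _ _ => by positivity) (sum_average_weights n)
    (fun c _ => hf.matchedVariance c) (fun c _ => h c)
  simp only [← varEstimator_eq_average, integral_varEstimator hf] at this
  exact this

theorem varEstimator_eq_zero [Nonempty 𝒳] (hn : n ≠ 0) (hf : BoundedMeasurable f)
    (hM : seminormM f = 0) (x : Fin (n + 1) → 𝒳) : varEstimator f x = 0 := by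
  obtain ⟨C, hC⟩ := hf.2
  have h : ∀ c i, matchedDiff f c i x = 0 := fun c i =>
    le_antisymm ((matchedDiff_le hn hC c i x).trans_eq hM) (matchedDiff_nonneg c i x)
  rw [varEstimator_eq_average]
  simp [matchedVariance, h]

variable {Ω : Type*} [MeasurableSpace Ω] {P : Measure Ω} [IsProbabilityMeasure P]
  {X : Fin (n + 1) → Ω → 𝒳}

/-- Both one-sided deviations of the square root of the variance estimator have
probability at most `δ`. -/
theorem measureReal_sqrt_varEstimator_deviation_le (hn : 2 ≤ n) (hf : BoundedMeasurable f)
    (hX : ∀ i, Measurable (X i)) (hindep : iIndepFun X P) (hlaw : ∀ i, P.map (X i) = μ)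
    {δ : ℝ} (hδ : δ ∈ Set.Ioo (0 : ℝ) 1) :
    P.real {ω | √((2 * seminormM f ^ 2 + 8 * seminormJ f ^ 2) * Real.log (1 / δ))
        < √(∫ x, sumCondVar (fun _ => μ) f x ∂(Measure.pi fun _ : Fin n => μ))
          - √(varEstimator f fun i => X i ω)} ≤ δ ∧
    P.real {ω | √((2 * seminormM f ^ 2 + 8 * seminormJ f ^ 2) * Real.log (1 / δ))
        < √(varEstimator f fun i => X i ω)
          - √(∫ x, sumCondVar (fun _ => μ) f x ∂(Measure.pi fun _ : Fin n => μ))} ≤ δ := by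
  have hne : Nonempty 𝒳 := nonempty_of_isProbabilityMeasure μ
  set a := 2 * seminormM f ^ 2 + 8 * seminormJ f ^ 2 with ha
  have ha0 : 0 ≤ a := by positivity
  have hL : 0 < Real.log (1 / δ) := Real.log_pos (by rw [lt_div_iff₀ hδ.1]; linarith [hδ.2])
  have hE : 0 ≤ ∫ x, sumCondVar (fun _ => μ) f x ∂(Measure.pi fun _ : Fin n => μ) := by
    rw [← integral_varEstimator hf]
    exact integral_nonneg (varEstimator_nonneg f)
  -- The Chernoff bounds divide by `a`; if `a = 0` then `M(f) = 0` and the estimator vanishes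
  -- identically.
  rcases ha0.eq_or_lt with ha00 | hapos
  · have hM : seminormM f = 0 := by
      have : seminormM f ^ 2 = 0 := by nlinarith [sq_nonneg (seminormM f), sq_nonneg (seminormJ f)]
      simpa using this
    have hv := varEstimator_eq_zero (by omega) hf hM
    rw [← integral_varEstimator hf]
    simp only [hv]
    simp [← ha00, hδ.1.le]
  have hXm : Measurable fun ω i => X i ω := measurable_pi_lambda _ hX
  have hmap : P.map (fun ω i => X i ω) = Measure.pi fun _ : Fin (n + 1) => μ := by
    rw [(iIndepFun_iff_map_fun_eq_pi_map fun i => (hX i).aemeasurable).1 hindep]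
    simp [hlaw]
  have hmgf : ∀ t, mgf (fun ω => varEstimator f fun i => X i ω) P t
      = mgf (varEstimator f) (Measure.pi fun _ : Fin (n + 1) => μ) t := fun t => by
    rw [← hmap, mgf_map hXm.aemeasurable
      (hf.varEstimator.exp_mul t).1.aestronglyMeasurable]
    rfl
  have hsb := isBlockSelfBounding_matchedVariance hn hf
  have ht : 0 < √(a * Real.log (1 / δ)) := Real.sqrt_pos.2 (mul_pos hapos hL)
  have hδe : Real.exp (-(√(a * Real.log (1 / δ)) ^ 2 / a)) = δ := by
    rw [Real.sq_sqrt (by positivity), mul_div_cancel_left₀ _ hapos.ne', one_div, Real.log_inv,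
      neg_neg, Real.exp_log hδ.1]
  constructor
  · refine (measureReal_lt_sqrt_sub_sqrt_le (hf.varEstimator.comp hXm)
      hapos hE (fun θ hθ => ?_) ht).trans_eq hδe
    rw [hmgf, ← neg_mul]
    refine mgf_varEstimator_le hf fun c => ?_
    rw [neg_mul]
    exact (hsb c).cgf_neg_le (biUnion_orbits c) hapos hθ
  · refine (measureReal_lt_sqrt_sub_sqrt_mean_le (hf.varEstimator.comp hXm)
      hapos hE (fun θ hθ haθ => ?_) ht).trans_eq hδe
    rw [hmgf]
    exact mgf_varEstimator_le hf fun c => (hsb c).cgf_le (biUnion_orbits c) hθ haθ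

end VarEstimator

theorem one_sub_le_measureReal {Ω : Type*} [MeasurableSpace Ω] {P : Measure Ω}
    [IsProbabilityMeasure P] {s t : Set Ω} (hst : ∀ ω, ω ∉ t → ω ∈ s) {δ : ℝ}
    (hs : P.real s ≤ δ) : 1 - δ ≤ P.real t := by
  have h1 : P.real (Set.univ : Set Ω) ≤ P.real (t ∪ s) := measureReal_mono fun ω _ => by
    by_cases h : ω ∈ t
    exacts [.inl h, .inr (hst ω h)]
  have h2 := measureReal_union_le (μ := P) t s
  rw [probReal_univ] at h1
  linarith

end WeakInteraction

theorem theorem1 {𝒳 : Type*} [MeasurableSpace 𝒳] (μ : Measure 𝒳) [IsProbabilityMeasure μ]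
    (n : ℕ) (hn : 2 ≤ n) (f : (Fin n → 𝒳) → ℝ) (hf : Measurable f)
    (hfb : ∃ C : ℝ, ∀ x, |f x| ≤ C)
    {Ω : Type*} [MeasurableSpace Ω] (P : Measure Ω) [IsProbabilityMeasure P]
    (X : Fin (n + 1) → Ω → 𝒳) (hX : ∀ i, Measurable (X i))
    (hindep : iIndepFun X P) (hlaw : ∀ i, P.map (X i) = μ)
    (δ : ℝ) (hδ : δ ∈ Set.Ioo (0 : ℝ) 1) :
    -- the two-sided bound
    1 - δ ≤ P.real {ω |
      |√(∫ x, WeakInteraction.sumCondVar (fun _ => μ) f x ∂(Measure.pi fun _ : Fin n => μ))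
        - √(WeakInteraction.varEstimator f (fun i => X i ω))|
      ≤ √((2 * WeakInteraction.seminormM f ^ 2 + 8 * WeakInteraction.seminormJ f ^ 2)
          * Real.log (2 / δ))} ∧
    -- the two one-sided bounds, with `1 / δ` in place of `2 / δ`
    1 - δ ≤ P.real {ω |
      √(∫ x, WeakInteraction.sumCondVar (fun _ => μ) f x ∂(Measure.pi fun _ : Fin n => μ))
        - √(WeakInteraction.varEstimator f (fun i => X i ω))
      ≤ √((2 * WeakInteraction.seminormM f ^ 2 + 8 * WeakInteraction.seminormJ f ^ 2)
          * Real.log (1 / δ))} ∧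
    1 - δ ≤ P.real {ω |
      √(WeakInteraction.varEstimator f (fun i => X i ω))
        - √(∫ x, WeakInteraction.sumCondVar (fun _ => μ) f x ∂(Measure.pi fun _ : Fin n => μ))
      ≤ √((2 * WeakInteraction.seminormM f ^ 2 + 8 * WeakInteraction.seminormJ f ^ 2)
          * Real.log (1 / δ))} := by
  have hfB : WeakInteraction.BoundedMeasurable f := ⟨hf, hfb⟩
  have key := fun {δ : ℝ} (hδ : δ ∈ Set.Ioo (0 : ℝ) 1) =>
    WeakInteraction.measureReal_sqrt_varEstimator_deviation_le hn hfB hX hindep hlaw hδ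
  refine ⟨?_, WeakInteraction.one_sub_le_measureReal (fun ω hω => ?_) (key hδ).1,
    WeakInteraction.one_sub_le_measureReal (fun ω hω => ?_) (key hδ).2⟩
  · have hδ2 : δ / 2 ∈ Set.Ioo (0 : ℝ) 1 := ⟨by linarith [hδ.1], by linarith [hδ.2]⟩
    have h := key hδ2
    rw [one_div_div] at h
    refine WeakInteraction.one_sub_le_measureReal (fun ω hω => ?_)
      ((measureReal_union_le _ _).trans (add_le_add h.1 h.2) |>.trans_eq (add_halves δ))
    simp only [Set.mem_ofPred_eq, not_le, lt_abs, neg_sub] at hω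
    exact hω
  · simpa only [Set.mem_ofPred_eq, not_le] using hω
  · simpa only [Set.mem_ofPred_eq, not_le] using hω
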